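/- **Setting.** A causal Bayesian network (CBN) with input and latent variables consists of finite pairwise disjoint sets $J$ (input), $V$ (observed output) and $U$ (latent output), an acyclic directed graph $G$ on $J\cup U\cup V$ without edges into $J$, a measurable space $\mathcal X_v$ for each node $v$, standard Borel if $v\in U\cup V$, and for each $v\in U\cup V$ a Markov kernel $P_v(X_v\mid \mathrm{do}(X_{\mathrm{Pa}(v)}))$ from $\mathcal X_{\mathrm{Pa}(v)}$ to $\mathcal X_v$, where $\mathcal X_S=\prod_{v\in S}\mathcal X_v$. Its joint Markov kernel $P(X_U,X_V\mid\mathrm{do}(X_J)):\mathcal X_J\dashrightarrow\mathcal X_{U\cup V}$ is the product of the $P_v$ in reverse order of a fixed topological order. *Interventions.* For $W\subseteq J\cup V$ the hard intervention on $W$ turns the nodes of $W$ into input nodes, deleting all edges into $W$ and the kernels $P_w$, $w\in W$; its joint kernel is $P(X_U,X_{V\setminus W}\mid \mathrm{do}(X_{J\cup W}))$. The soft intervention on $W\subseteq V$ adds for each $w\in W$ an input node $I_w$ with an edge $I_w\to w$ and $\mathcal X_{I_w}=\mathcal X_w\sqcup\{\star\}$; the new kernel of $X_w$ is $P_w$ if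 $X_{I_w}=\star$, and the point mass at $X_{I_w}$ otherwise. Write $X_{I_W}=(X_{I_w})_{w\in W}$. *Graphs.* $G(V\setminus D\mid \mathrm{do}(D\cup J))$ and $G(V\setminus D\mid\mathrm{do}(D\cup J,I_B))$ denote the latent projections, obtained by marginalizing out $U$, of the graphs of the network after the hard intervention on $D$, respectively after the hard intervention on $D$ and the soft intervention on $B$. (In the latent projection, $v\to w$ if there is a directed walk from $v$ to $w$ of positive length with all intermediate nodes in $U$; $v\leftrightarrow w$, for $v\ne w$, if there is a node of $U$ with directed walks to $v$ and to $w$ with all intermediate nodes in $U$.) In a directed mixed graph with input nodes $J'$, let $\mathrm{Sc}(v)$ be the strongly connected component of $v$. A walk is $\sigma$-blocked by $S$ if an end node lies in $S$, or it contains a collider not in $S$, or a non-collider $v_k\in S$ in a left chain $v_{k-1}\leftarrow v_k\,{\leftarrow}{*}\,v_{k+1}$ with $v_k\notin\mathrm{Sc}(v_{k-1})$, a right chain $v_{k-1}\,{*}{\to}\,v_k\to v_{k+1}$ with $v_k\notin\mathrm{Sc}(v_{k+1})$, or a fork $v_{k-1}\leftarrow v_k\to v_{k+1}$ with $v_k\notin\mathrm{Sc}(v_{k-1})\cap\mathrm{Sc}(v_{k+1})$;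 here $*$ is an arrow head or a tail, and $v_k$ is a collider if both edges have arrow heads at it. Then $A\perp^\sigma B\mid S$ means that every walk from a node of $A$ to a node of $J'\cup B$ is $\sigma$-blocked by $S$. *Versions.* For a network with inputs $J'$ and sets $A,S$ of observed output nodes, a Markov kernel $Q$ from $\mathcal X_S\times\mathcal X_{J'}$ to $\mathcal X_A$ is a version of $P(X_A\mid X_S,\mathrm{do}(X_{J'}))$ if $P(X_A,X_S\mid\mathrm{do}(X_{J'}))=Q\otimes P(X_S\mid \mathrm{do}(X_{J'}))$. A kernel depending on fewer coordinates is viewed as a kernel of all of them. A subset of $\mathcal X_S\times\mathcal X_{J'}$ is a $P(X_S\mid\mathrm{do}(X_{J'}))$-null set if for each $t\in\mathcal X_{J'}$ its section at $t$ is a $P(X_S\mid \mathrm{do}(X_{J'}=t))$-null set. **Corollary (Do-calculus).** Consider a CBN as above, and let $A,B,C\subseteq V$ and $D\subseteq J\cup V$ be pairwise disjoint. 1. *(Insertion/deletion of observations)* If $A\perp^\sigma B\mid C\cup D$ in $G(V\setminus D\mid\mathrm{do}(D\cup J))$, then there is a Markov kernel $\mathcal X_C\times\mathcal X_D\dashrightarrow\mathcal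 X_A$ that is a version of $P(X_A\mid X_{\tilde B},X_C,\mathrm{do}(X_{D\cup J}))$ simultaneously for all $\tilde B\subseteq B$. Any two such Markov kernels agree up to a $P(X_C\mid\mathrm{do}(X_{D\cup J}))$-null set. 2. *(Action/observation exchange)* If $A\perp^\sigma I_B\mid B\cup C\cup D$ in $G(V\setminus D\mid\mathrm{do}(D\cup J,I_B))$, then there is a Markov kernel $\mathcal X_B\times\mathcal X_C\times\mathcal X_D\dashrightarrow\mathcal X_A$ that is a version of $P(X_A\mid X_{B_1},X_C,\mathrm{do}(X_{B_2}),\mathrm{do}(X_{D\cup J}))$ simultaneously for all disjoint decompositions $B=B_1\sqcup B_2$. Any two such Markov kernels agree up to a $P(X_{B\cup C}\mid\mathrm{do}(X_{D\cup J},X_{I_B}))$-null set. 3. *(Insertion/deletion of actions)* If $A\perp^\sigma I_B\mid C\cup D$ in $G(V\setminus D\mid\mathrm{do}(D\cup J,I_B))$, then there is a Markov kernel $\mathcal X_C\times\mathcal X_D\dashrightarrow\mathcal X_A$ that is a version of $P(X_A\mid X_C,\mathrm{do}(X_{\tilde B}),\mathrm{do}(X_{D\cup J}))$ simultaneously for all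 $\tilde B\subseteq B$. Any two such Markov kernels agree up to a $P(X_C\mid\mathrm{do}(X_{D\cup J},X_{I_B}))$-null set. -/

import Mathlib

open MeasureTheory ProbabilityTheory

/-! ### Spaces of values -/

/-- The product space `𝒳_S = ∏_{v ∈ S} 𝒳_v` (with the product σ-algebra); it is a one-point space
for `S = ∅`. -/
abbrev Val {N : Type*} (𝒳 : N → Type*) (S : Set N) : Type _ := (v : S) → 𝒳 v

namespace Val

variable {N : Type*} {𝒳 : N → Type*}

/-- The projection `𝒳_S → 𝒳_R` for `R ⊆ S`. -/
def proj {R S : Set N} (h : R ⊆ S) (x : Val 𝒳 S) : Val 𝒳 R := fun v => x ⟨v, h v.2⟩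

open scoped Classical in
/-- For `R ⊆ S ∪ T`, read off the coordinates in `R` from a pair `(x_S, x_T)`. It is only used for
disjoint `S` and `T`. -/
noncomputable def merge {R S T : Set N} (h : R ⊆ S ∪ T) (p : Val 𝒳 S × Val 𝒳 T) : Val 𝒳 R :=
  fun v => if hv : (v : N) ∈ S then p.1 ⟨v, hv⟩ else p.2 ⟨v, (h v.2).resolve_left hv⟩

open scoped Classical in
/-- Add a coordinate `x_v` to a tuple indexed by the members of a list. -/
noncomputable def cons (v : N) (l : List N) (p : Val 𝒳 {w | w ∈ l} × 𝒳 v) :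
    Val 𝒳 {w | w ∈ v :: l} :=
  fun w => if hw : (w : N) = v then cast (congrArg 𝒳 hw.symm) p.2
    else p.1 ⟨w, (List.mem_cons.1 w.2).resolve_left hw⟩

variable [∀ v, MeasurableSpace (𝒳 v)]

theorem measurable_proj {R S : Set N} (h : R ⊆ S) :
    Measurable (proj h : Val 𝒳 S → Val 𝒳 R) :=
  measurable_pi_iff.2 fun _ => measurable_pi_apply _

theorem measurable_merge {R S T : Set N} (h : R ⊆ S ∪ T) :
    Measurable (merge h : Val 𝒳 S × Val 𝒳 T → Val 𝒳 R) := by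
  refine measurable_pi_iff.2 fun v => ?_
  by_cases hv : (v : N) ∈ S
  · simp only [merge, dif_pos hv]
    exact (measurable_pi_apply (⟨v, hv⟩ : S)).comp measurable_fst
  · simp only [merge, dif_neg hv]
    exact (measurable_pi_apply (⟨v, (h v.2).resolve_left hv⟩ : T)).comp measurable_snd

theorem measurable_cons (v : N) (l : List N) :
    Measurable (cons v l : Val 𝒳 {w | w ∈ l} × 𝒳 v → Val 𝒳 {w | w ∈ v :: l}) := by
  refine measurable_pi_iff.2 fun w => ?_
  obtain ⟨w, hw'⟩ := w
  by_cases hw : w = v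
  · subst hw
    simpa only [cons, dif_pos, cast_eq] using measurable_snd
  · simp only [cons, dif_neg hw]
    exact (measurable_pi_apply
      (⟨w, (List.mem_cons.1 hw').resolve_left hw⟩ : {w | w ∈ l})).comp measurable_fst

end Val

/-! ### Conditional directed mixed graphs -/

/-- A conditional directed mixed graph with nodes in `N`: input nodes `J`, output nodes `V`,
directed edges `E w v` (meaning `w → v`) and bidirected edges `L v w` (meaning `v ↔ w`). -/
structure CDMG (N : Type*) where
  J : Set N
  V : Set N
  disj : Disjoint J V
  E : N → N → Prop
  L : N → N → Prop
  E_source : ∀ {w v}, E w v → w ∈ J ∪ V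
  E_target : ∀ {w v}, E w v → v ∈ V
  L_mem : ∀ {v w}, L v w → v ∈ V
  L_symm : ∀ {v w}, L v w → L w v
  L_ne : ∀ {v w}, L v w → v ≠ w

/-- The three orientations of a step of a walk from `v` to `w`. -/
inductive EdgeKind
  /-- `v → w` -/
  | fwd
  /-- `v ← w` -/
  | bwd
  /-- `v ↔ w` -/
  | bi

namespace EdgeKind

/-- The step has an arrow head at its second node. -/
def HeadAtEnd (e : EdgeKind) : Prop := e = fwd ∨ e = bi

/-- The step has an arrow head at its first node. -/
def HeadAtStart (e : EdgeKind) : Prop := e = bwd ∨ e = bi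

end EdgeKind

namespace CDMG

variable {N : Type*}

/-- The parents of `v`. -/
def Pa (G : CDMG N) (v : N) : Set N := {w | G.E w v}

/-- The ancestors of `v` (including `v`): start nodes of directed walks to `v`. -/
def Anc (G : CDMG N) (v : N) : Set N := {w | Relation.ReflTransGen G.E w v}

/-- The descendants of `v` (including `v`). -/
def Desc (G : CDMG N) (v : N) : Set N := {w | Relation.ReflTransGen G.E v w}

/-- The strongly connected component of `v`. -/
def Sc (G : CDMG N) (v : N) : Set N := G.Anc v ∩ G.Desc v

/-- Every directed walk from a node to itself is trivial. -/
def Acyclic (G : CDMG N) : Prop := ∀ v, ¬ Relation.TransGen G.E v v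

/-- `v → w`, `v ← w` or `v ↔ w` is an edge of the graph. -/
def HasEdge (G : CDMG N) : EdgeKind → N → N → Prop
  | .fwd, v, w => G.E v w
  | .bwd, v, w => G.E w v
  | .bi, v, w => G.L v w

/-- Walks in the graph: finite sequences of nodes and edges, with repetitions allowed. -/
inductive Walk (G : CDMG N) : N → N → Type _
  | nil (v : N) (hv : v ∈ G.J ∪ G.V) : Walk G v v
  | cons {v w u : N} (e : EdgeKind) (h : G.HasEdge e v w) (p : Walk G w u) : Walk G v u

/-- The two adjacent edges `v -e- w -e'- u` σ-block a walk, given `C`: as a left chain, a right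
chain, a fork or a collider. -/
def BlockedAt (G : CDMG N) (C : Set N) (v : N) (e : EdgeKind) (w : N) (e' : EdgeKind) (u : N) :
    Prop :=
  (e = .bwd ∧ e'.HeadAtStart ∧ w ∈ C ∧ w ∉ G.Sc v) ∨
  (e.HeadAtEnd ∧ e' = .fwd ∧ w ∈ C ∧ w ∉ G.Sc u) ∨
  (e = .bwd ∧ e' = .fwd ∧ w ∈ C ∧ w ∉ G.Sc v ∩ G.Sc u) ∨
  (e.HeadAtEnd ∧ e'.HeadAtStart ∧ w ∉ C)

/-- Some pair of adjacent edges of the walk σ-blocks it. -/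
def Walk.InnerBlocked {G : CDMG N} (C : Set N) : {a b : N} → G.Walk a b → Prop
  | _, _, .nil _ _ => False
  | _, _, .cons _ _ (.nil _ _) => False
  | a, _, .cons e _ (.cons (v := w) (w := u) e' h' p) =>
      G.BlockedAt C a e w e' u ∨ Walk.InnerBlocked C (.cons e' h' p)

/-- The walk is σ-blocked by `C`. -/
def Walk.Blocked {G : CDMG N} (C : Set N) {a b : N} (p : G.Walk a b) : Prop :=
  a ∈ C ∨ b ∈ C ∨ p.InnerBlocked C

/-- `A` is σ-separated from `B` given `C`: every walk from a node of `A` to a node of `J ∪ B` is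
σ-blocked by `C` (note the input nodes `J`). -/
def SigmaSep (G : CDMG N) (A B C : Set N) : Prop :=
  ∀ a ∈ A, ∀ b ∈ G.J ∪ B, ∀ p : G.Walk a b, p.Blocked C

/-- The hard interventional graph: the nodes in `W` become input nodes and all arrow heads at them
are removed. -/
def hard (G : CDMG N) (W : Set N) : CDMG N where
  J := G.J ∪ W
  V := G.V \ W
  disj := by
    rw [Set.disjoint_left]
    rintro v (hv | hv) hv'
    · exact Set.disjoint_left.1 G.disj hv hv'.1
    · exact hv'.2 hv
  E w v := G.E w v ∧ v ∉ W
  L v w := G.L v w ∧ v ∉ W ∧ w ∉ W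
  E_source := by
    rintro w v ⟨h, -⟩
    by_cases hw : w ∈ W
    · exact Or.inl (Or.inr hw)
    · exact (G.E_source h).imp Or.inl fun h => ⟨h, hw⟩
  E_target h := ⟨G.E_target h.1, h.2⟩
  L_mem h := ⟨G.L_mem h.1, h.2.1⟩
  L_symm h := ⟨G.L_symm h.1, h.2.2, h.2.1⟩
  L_ne h := G.L_ne h.1

/-- The soft interventional graph: the old nodes are `Sum.inl v`, and there is a new input node
`I_w = Sum.inr w` for every `w ∈ W`, with an edge `I_w → w` if `w` is an output node. -/
def soft (G : CDMG N) (W : Set N) : CDMG (N ⊕ N) where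
  J := Sum.inl '' G.J ∪ Sum.inr '' W
  V := Sum.inl '' G.V
  disj := by
    rw [Set.disjoint_left]
    rintro _ (⟨v, hv, rfl⟩ | ⟨v, hv, rfl⟩) ⟨w, hw, h⟩
    · cases h
      exact Set.disjoint_left.1 G.disj hv hw
    · cases h
  E
    | .inl w, .inl v => G.E w v
    | .inr w, .inl v => w = v ∧ v ∈ W ∧ v ∈ G.V
    | _, .inr _ => False
  L
    | .inl v, .inl w => G.L v w
    | _, _ => False
  E_source := by
    rintro (w | w) (v | v) h
    · exact (G.E_source h).imp (fun h => Or.inl ⟨w, h, rfl⟩) fun h => ⟨w, h, rfl⟩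
    · exact h.elim
    · exact Or.inl (Or.inr ⟨w, h.1 ▸ h.2.1, rfl⟩)
    · exact h.elim
  E_target := by
    rintro (w | w) (v | v) h
    · exact ⟨v, G.E_target h, rfl⟩
    · exact h.elim
    · exact ⟨v, h.2.2, rfl⟩
    · exact h.elim
  L_mem := by
    rintro (w | w) (v | v) h
    · exact ⟨w, G.L_mem h, rfl⟩
    all_goals exact h.elim
  L_symm := by
    rintro (w | w) (v | v) h
    · exact G.L_symm h
    all_goals exact h.elim
  L_ne := by
    rintro (w | w) (v | v) h
    · exact fun h' => G.L_ne h (Sum.inl.inj h')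
    all_goals exact h.elim

/-- There is a directed walk of length at least one from the first to the second node with all
intermediate nodes in `W`. -/
inductive DirThrough (G : CDMG N) (W : Set N) : N → N → Prop
  | edge {v w : N} (h : G.E v w) : DirThrough G W v w
  | cons {v w u : N} (h : G.E v w) (hw : w ∈ W) (p : DirThrough G W w u) : DirThrough G W v u

/-- There is a walk `v ← ⋯ ← a ∗→ b → ⋯ → w` with all intermediate nodes in `W` and with arrow
heads at both ends: either its source is a common ancestor in `W`, or it has a middle edge
`a ↔ b`. -/
def Trek (G : CDMG N) (W : Set N) (v w : N) : Prop :=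
  (∃ u ∈ W, G.DirThrough W u v ∧ G.DirThrough W u w) ∨
  ∃ a b, G.L a b ∧ (a = v ∨ a ∈ W ∧ G.DirThrough W a v) ∧ (b = w ∨ b ∈ W ∧ G.DirThrough W b w)

/-- The marginalized graph (latent projection), where the output nodes in `W` are marginalized out. -/
def marginalize (G : CDMG N) (W : Set N) : CDMG N where
  J := G.J
  V := G.V \ W
  disj := G.disj.mono_right Set.sdiff_subset
  E w v := w ∈ G.J ∪ G.V \ W ∧ v ∈ G.V \ W ∧ G.DirThrough W w v
  L v w := v ∈ G.V \ W ∧ w ∈ G.V \ W ∧ v ≠ w ∧ G.Trek W v w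
  E_source h := h.1
  E_target h := h.2.1
  L_mem h := h.1
  L_symm := by
    rintro v w ⟨hv, hw, hne, h⟩
    refine ⟨hw, hv, hne.symm, ?_⟩
    rcases h with ⟨u, hu, h₁, h₂⟩ | ⟨a, b, hab, h₁, h₂⟩
    · exact Or.inl ⟨u, hu, h₂, h₁⟩
    · exact Or.inr ⟨b, a, G.L_symm hab, h₂, h₁⟩
  L_ne h := h.2.2.1

/-- The list consists of distinct output nodes, and all parents of a member are input nodes or
come after it in the list. -/
def IsOrdered (G : CDMG N) : List N → Prop
  | [] => True
  | v :: l => v ∈ G.V ∧ v ∉ l ∧ G.Pa v ⊆ G.J ∪ {w | w ∈ l} ∧ IsOrdered G l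

/-- A topological order of the output nodes (all input nodes coming first), listed in reverse,
i.e. from the last node to the first one. -/
structure TopOrder (G : CDMG N) where
  list : List N
  ordered : G.IsOrdered list
  complete : G.V ⊆ {v | v ∈ list}

/-- A finite acyclic graph has a topological order. -/
theorem Acyclic.nonempty_topOrder [Finite N] {G : CDMG N} (hG : G.Acyclic) :
    Nonempty G.TopOrder := by
  classical
  have hnd : ∀ l, G.IsOrdered l → l.Nodup := by
    intro l
    induction l with
    | nil => simp
    | cons v l ih => exact fun h => List.nodup_cons.2 ⟨h.2.1, ih h.2.2.2⟩
  have hwf : WellFounded (Relation.TransGen G.E) := by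
    have : Std.Irrefl (Relation.TransGen G.E) := ⟨hG⟩
    exact Finite.wellFounded_of_trans_of_irrefl _
  have := Fintype.ofFinite N
  by_contra hne
  have key : ∀ n : ℕ, ∃ l, G.IsOrdered l ∧ l.length = n := by
    intro n
    induction n with
    | zero => exact ⟨[], trivial, rfl⟩
    | succ n ih =>
      obtain ⟨l, hl, rfl⟩ := ih
      have hex : (G.V \ {v | v ∈ l}).Nonempty := by
        by_contra h
        rw [Set.not_nonempty_iff_eq_empty, Set.sdiff_eq_empty] at h
        exact hne ⟨⟨l, hl, h⟩⟩
      obtain ⟨v, hv, hmin⟩ := hwf.has_min _ hex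
      refine ⟨v :: l, ⟨hv.1, hv.2, fun w hw => ?_, hl⟩, rfl⟩
      refine (G.E_source hw).imp id fun hwV => ?_
      by_contra hwl
      exact hmin w ⟨hwV, hwl⟩ (.single hw)
  obtain ⟨l, hl, hlen⟩ := key (Fintype.card N + 1)
  have := (hnd l hl).length_le_card
  omega

open scoped Classical in
/-- The topological order induced on a hard interventional graph. -/
noncomputable def TopOrder.hard {G : CDMG N} (o : G.TopOrder) (W : Set N) :
    (G.hard W).TopOrder where
  list := o.list.filter (· ∉ W)
  ordered := by
    have h : ∀ l, G.IsOrdered l → (G.hard W).IsOrdered (l.filter (· ∉ W)) := by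
      intro l
      induction l with
      | nil => exact fun _ => trivial
      | cons v l ih =>
        intro hl
        by_cases hv : v ∈ W
        · simpa [hv] using ih hl.2.2.2
        · rw [List.filter_cons_of_pos (by simpa using hv)]
          refine ⟨⟨hl.1, hv⟩, fun h => hl.2.1 (List.mem_filter.1 h).1, fun w hw => ?_,
            ih hl.2.2.2⟩
          by_cases hwW : w ∈ W
          · exact Or.inl (Or.inr hwW)
          · rcases hl.2.2.1 hw.1 with h | h
            · exact Or.inl (Or.inl h)
            · exact Or.inr (List.mem_filter.2 ⟨h, by simpa using hwW⟩)
    exact h _ o.ordered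
  complete := fun v hv => List.mem_filter.2 ⟨o.complete hv.1, by simpa using hv.2⟩

/-- The topological order induced on a soft interventional graph. -/
def TopOrder.soft {G : CDMG N} (o : G.TopOrder) (W : Set N) : (G.soft W).TopOrder where
  list := o.list.map Sum.inl
  ordered := by
    have h : ∀ l, G.IsOrdered l → (G.soft W).IsOrdered (l.map Sum.inl) := by
      intro l
      induction l with
      | nil => exact fun _ => trivial
      | cons v l ih =>
        intro hl
        refine ⟨⟨v, hl.1, rfl⟩, fun h => hl.2.1 ?_, ?_, ih hl.2.2.2⟩
        · obtain ⟨w, hw, h⟩ := List.mem_map.1 h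
          cases h
          exact hw
        · rintro (w | w) hw
          · rcases hl.2.2.1 (show w ∈ G.Pa v from hw) with h | h
            · exact Or.inl (Or.inl ⟨w, h, rfl⟩)
            · exact Or.inr (List.mem_map.2 ⟨w, h, rfl⟩)
          · have hw' : w = v ∧ v ∈ W ∧ v ∈ G.V := hw
            exact Or.inl (Or.inr ⟨w, hw'.1 ▸ hw'.2.1, rfl⟩)
    exact h _ o.ordered
  complete := by
    rintro _ ⟨v, hv, rfl⟩
    exact List.mem_map.2 ⟨v, o.complete hv, rfl⟩

theorem inl_mem_Pa_soft {G : CDMG N} {W : Set N} {v : N} :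
    ∀ w ∈ G.Pa v, Sum.inl w ∈ (G.soft W).Pa (Sum.inl v) := fun _ h => h

theorem Acyclic.hard {G : CDMG N} (h : G.Acyclic) (W : Set N) : (G.hard W).Acyclic :=
  fun v hv => h v (Relation.TransGen.mono (fun _ _ h => h.1) _ _ hv)

theorem Acyclic.soft {G : CDMG N} (h : G.Acyclic) (W : Set N) : (G.soft W).Acyclic := by
  have key : ∀ x y, Relation.TransGen (G.soft W).E x y → ∀ v, x = Sum.inl v →
      ∃ w, y = Sum.inl w ∧ Relation.TransGen G.E v w := by
    rintro x y hxy v rfl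
    induction hxy with
    | @single z hz =>
      rcases z with w | w
      · exact ⟨w, rfl, .single hz⟩
      · exact hz.elim
    | @tail z y _ hz ih =>
      obtain ⟨w, rfl, hw⟩ := ih
      rcases y with u | u
      · exact ⟨u, rfl, hw.tail hz⟩
      · exact hz.elim
  rintro (v | v) hv
  · obtain ⟨w, hw, hvw⟩ := key _ _ hv v rfl
    cases hw
    exact h v hvw
  · obtain ⟨z, -, hz⟩ := (Relation.TransGen.tail'_iff).1 hv
    rcases z with z | z <;> exact hz.elim

end CDMG

/-! ### Causal Bayesian networks -/

/-- A causal Bayesian network with input variables `X_j`, `j ∈ J = G.J`, latent output variables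
`X_u`, `u ∈ U`, and observed output variables `X_v`, `v ∈ G.V \ U`: an acyclic graph on the input
and output nodes without bidirected edges, and for every output node `v` a Markov kernel
`P_v(X_v | do(X_{Pa(v)}))`; the spaces of the output variables are standard. -/
structure CausalBN {N : Type*} (𝒳 : N → Type*) [∀ v, MeasurableSpace (𝒳 v)] where
  G : CDMG N
  U : Set N
  U_subset : U ⊆ G.V
  directed : ∀ v w, ¬ G.L v w
  acyclic : G.Acyclic
  standard : ∀ v ∈ G.V, StandardBorelSpace (𝒳 v)
  kernel : (v : G.V) → Kernel (Val 𝒳 (G.Pa v)) (𝒳 v)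
  markov : ∀ v, IsMarkovKernel (kernel v)

/-- The spaces of the variables of a soft intervention model: `𝒳_{I_w} = 𝒳_w ⊔ {⋆}`, where
`⋆ = Sum.inr ()` stands for no intervention. -/
def SoftSpace {N : Type*} (𝒳 : N → Type*) : N ⊕ N → Type _
  | .inl v => 𝒳 v
  | .inr w => 𝒳 w ⊕ Unit

instance SoftSpace.instMeasurableSpace {N : Type*} (𝒳 : N → Type*)
    [∀ v, MeasurableSpace (𝒳 v)] : ∀ x, MeasurableSpace (SoftSpace 𝒳 x)
  | .inl v => inferInstanceAs (MeasurableSpace (𝒳 v))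
  | .inr w => inferInstanceAs (MeasurableSpace (𝒳 w ⊕ Unit))

namespace Val

variable {N : Type*} {𝒳 : N → Type*}

/-- The identification of tuples indexed by a set of old nodes in a soft intervention model with
tuples of the original model (for the copy `S'` of a set, or a larger set of nodes). -/
def unlift {R : Set N} {S' : Set (N ⊕ N)} (h : ∀ v ∈ R, Sum.inl v ∈ S')
    (x : Val (SoftSpace 𝒳) S') : Val 𝒳 R :=
  fun v => x ⟨Sum.inl v, h v v.2⟩

theorem measurable_unlift [∀ v, MeasurableSpace (𝒳 v)] {R : Set N} {S' : Set (N ⊕ N)}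
    (h : ∀ v ∈ R, Sum.inl v ∈ S') :
    Measurable (unlift h : Val (SoftSpace 𝒳) S' → Val 𝒳 R) :=
  measurable_pi_iff.2 fun v => measurable_pi_apply (⟨Sum.inl v, h v v.2⟩ : S')

end Val

/-- The kernel `P(X_w | do(X_{Pa(w)}), X_{I_w})` of a node `w` with soft intervention node `I_w`:
it is the given kernel if `X_{I_w} = ⋆`, and the point mass at `X_{I_w}` otherwise. -/
noncomputable def softKernel {Y Z : Type*} [MeasurableSpace Y] [MeasurableSpace Z]
    (κ : Kernel Y Z) : Kernel ((Z ⊕ Unit) × Y) Z where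
  toFun p := Sum.elim Measure.dirac (fun _ => κ p.2) p.1
  measurable' := by
    have h : (fun p : (Z ⊕ Unit) × Y => Sum.elim Measure.dirac (fun _ => κ p.2) p.1) =
        Sum.elim (fun q : Z × Y => Measure.dirac q.1) (fun q : Unit × Y => κ q.2) ∘
          MeasurableEquiv.sumProdDistrib Z Unit Y := by
      funext p
      obtain ⟨z | z, y⟩ := p <;> rfl
    rw [h]
    exact (Measurable.sumElim (Measure.measurable_dirac.comp measurable_fst)
      (κ.measurable.comp measurable_snd)).comp (MeasurableEquiv.measurable _)

theorem softKernel_markov {Y Z : Type*} [MeasurableSpace Y] [MeasurableSpace Z]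
    (κ : Kernel Y Z) [IsMarkovKernel κ] : IsMarkovKernel (softKernel κ) := by
  refine ⟨?_⟩
  rintro ⟨z | z, y⟩
  · exact (inferInstance : IsProbabilityMeasure (Measure.dirac z))
  · exact (inferInstance : IsProbabilityMeasure (κ y))

namespace CausalBN

variable {N : Type*} {𝒳 : N → Type*} [∀ v, MeasurableSpace (𝒳 v)]

/-- The observed output nodes. -/
def V (M : CausalBN 𝒳) : Set N := M.G.V \ M.U

/-- The marginal graph on the input nodes and the observed output nodes. -/
def marginalGraph (M : CausalBN 𝒳) : CDMG N := M.G.marginalize M.U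

/-- The product `⨂_{v ∈ l} P_v(X_v | do(X_{Pa(v)}))` in reverse order (children to the left of
their parents), as a kernel from the input space. -/
noncomputable def productKernel (M : CausalBN 𝒳) :
    (l : List N) → M.G.IsOrdered l → Kernel (Val 𝒳 M.G.J) (Val 𝒳 {w | w ∈ l})
  | [], _ => Kernel.deterministic (fun _ w => absurd w.2 List.not_mem_nil)
      (measurable_pi_iff.2 fun w => absurd w.2 List.not_mem_nil)
  | v :: l, h =>
      (M.productKernel l h.2.2.2 ⊗ₖ
        (M.kernel ⟨v, h.1⟩).comap (Val.merge h.2.2.1) (Val.measurable_merge _)).map (Val.cons v l)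

theorem productKernel_markov (M : CausalBN 𝒳) :
    ∀ (l : List N) (h : M.G.IsOrdered l), IsMarkovKernel (M.productKernel l h)
  | [], _ => by unfold productKernel; infer_instance
  | v :: l, h => by
      have := M.productKernel_markov l h.2.2.2
      have := M.markov ⟨v, h.1⟩
      unfold productKernel
      exact Kernel.IsMarkovKernel.map _ (Val.measurable_cons v l)

/-- The joint Markov kernel `P(X_U, X_V | do(X_J))`. -/
noncomputable def joint (M : CausalBN 𝒳) (o : M.G.TopOrder) :
    Kernel (Val 𝒳 M.G.J) (Val 𝒳 M.G.V) :=
  (M.productKernel o.list o.ordered).map (Val.proj o.complete)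

/-- The marginal Markov kernel `P(X_S | do(X_J))` for a set `S` of observed output nodes. -/
noncomputable def marginal (M : CausalBN 𝒳) (o : M.G.TopOrder) (S : Set N) (hS : S ⊆ M.V) :
    Kernel (Val 𝒳 M.G.J) (Val 𝒳 S) :=
  (M.joint o).map (Val.proj (hS.trans Set.sdiff_subset))

/-- The marginal Markov kernel `P(X_S, X_A | do(X_J))` in two variables. -/
noncomputable def marginalPair (M : CausalBN 𝒳) (o : M.G.TopOrder) (S A : Set N)
    (hS : S ⊆ M.V) (hA : A ⊆ M.V) : Kernel (Val 𝒳 M.G.J) (Val 𝒳 S × Val 𝒳 A) :=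
  (M.joint o).map fun x =>
    (Val.proj (hS.trans Set.sdiff_subset) x, Val.proj (hA.trans Set.sdiff_subset) x)

instance (M : CausalBN 𝒳) (o : M.G.TopOrder) : IsMarkovKernel (M.joint o) := by
  have := M.productKernel_markov o.list o.ordered
  exact Kernel.IsMarkovKernel.map _ (Val.measurable_proj _)

instance (M : CausalBN 𝒳) (o : M.G.TopOrder) (S A : Set N) (hS : S ⊆ M.V) (hA : A ⊆ M.V) :
    IsMarkovKernel (M.marginalPair o S A hS hA) :=
  Kernel.IsMarkovKernel.map _ ((Val.measurable_proj _).prodMk (Val.measurable_proj _))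

/-- The kernel `Q`, which depends on the variables in `R` only, is a version of the conditional
Markov kernel `P(X_A | X_S, do(X_J))` of the network. -/
def IsVersion (M : CausalBN 𝒳) (o : M.G.TopOrder) (A S : Set N) {R : Set N}
    (Q : Kernel (Val 𝒳 R) (Val 𝒳 A)) : Prop :=
  ∃ (hS : S ⊆ M.V) (hA : A ⊆ M.V) (hR : R ⊆ M.G.J ∪ S),
    (M.marginalPair o S A hS hA).IsCondKernel (Q.comap (Val.merge hR) (Val.measurable_merge hR))

/-- The hard interventional network: the nodes in `W` become input nodes. -/
noncomputable def hard (M : CausalBN 𝒳) (W : Set N) : CausalBN 𝒳 where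
  G := M.G.hard W
  U := M.U \ W
  U_subset := Set.sdiff_subset_sdiff_left M.U_subset
  directed v w h := M.directed v w h.1
  acyclic := M.acyclic.hard W
  standard v hv := M.standard v hv.1
  kernel v := (M.kernel ⟨v, v.2.1⟩).comap
    (Val.proj (R := M.G.Pa v) (S := (M.G.hard W).Pa v) fun _ hw => ⟨hw, v.2.2⟩)
    (Val.measurable_proj _)
  markov v := by
    have := M.markov ⟨v, v.2.1⟩
    infer_instance

open scoped Classical in
/-- The Markov kernels of the network with soft intervention nodes `I_w`, `w ∈ W`. -/
noncomputable def softNodeKernel (M : CausalBN 𝒳) (W : Set N) (v : N) (hv : v ∈ M.G.V) :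
    Kernel (Val (SoftSpace 𝒳) ((M.G.soft W).Pa (Sum.inl v))) (𝒳 v) :=
  if hW : v ∈ W then
    (softKernel (M.kernel ⟨v, hv⟩)).comap
      (fun x => ((x ⟨Sum.inr v, ⟨rfl, hW, hv⟩⟩ : 𝒳 v ⊕ Unit),
        Val.unlift CDMG.inl_mem_Pa_soft x))
      (Measurable.prodMk
        (measurable_pi_apply (⟨Sum.inr v, ⟨rfl, hW, hv⟩⟩ : (M.G.soft W).Pa (Sum.inl v)))
        (Val.measurable_unlift _))
  else (M.kernel ⟨v, hv⟩).comap (Val.unlift CDMG.inl_mem_Pa_soft) (Val.measurable_unlift _)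

theorem softNodeKernel_markov (M : CausalBN 𝒳) (W : Set N) (v : N) (hv : v ∈ M.G.V) :
    IsMarkovKernel (M.softNodeKernel W v hv) := by
  have := M.markov ⟨v, hv⟩
  have := softKernel_markov (M.kernel ⟨v, hv⟩)
  unfold softNodeKernel
  split_ifs <;> infer_instance

/-- The network with soft intervention nodes `I_w`, `w ∈ W`, modelling hard interventions:
`X_{I_w} = ⋆` means no intervention on `w`, and any other value of `X_{I_w}` is imposed on `X_w`. -/
noncomputable def soft (M : CausalBN 𝒳) (W : Set N) : CausalBN (SoftSpace 𝒳) where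
  G := M.G.soft W
  U := Sum.inl '' M.U
  U_subset := Set.image_mono M.U_subset
  directed := by
    rintro (v | v) (w | w) h
    · exact M.directed v w h
    all_goals exact h.elim
  acyclic := M.acyclic.soft W
  standard := by
    rintro _ ⟨v, hv, rfl⟩
    exact M.standard v hv
  kernel
    | ⟨.inl v, hv⟩ => M.softNodeKernel W v (by obtain ⟨w, hw, h⟩ := hv; cases h; exact hw)
    | ⟨.inr v, hv⟩ => absurd hv (by rintro ⟨w, -, h⟩; cases h)
  markov := by
    rintro ⟨v | v, hv⟩
    · exact M.softNodeKernel_markov W v _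
    · obtain ⟨w, -, h⟩ := hv
      cases h

end CausalBN

/-! ### Equality up to null sets -/

/-- Null sets with respect to a Markov kernel `K(W | T)`: every section is a null set. -/
def IsKernelNull {T W : Type*} [MeasurableSpace T] [MeasurableSpace W] (K : Kernel T W)
    (M : Set (W × T)) : Prop :=
  ∀ t, K t {w | (w, t) ∈ M} = 0

/-- Two kernels that depend on the variables in `R` only agree up to a `P(X_S | do(X_J))`-null
set. -/
def CausalBN.AgreeUpToNull {N : Type*} {𝒳 : N → Type*} [∀ v, MeasurableSpace (𝒳 v)]
    (M : CausalBN 𝒳) (o : M.G.TopOrder) (S : Set N) {R : Set N} {Y : Type*} [MeasurableSpace Y]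
    (Q Q' : Kernel (Val 𝒳 R) Y) : Prop :=
  ∃ (hS : S ⊆ M.V) (hR : R ⊆ M.G.J ∪ S), IsKernelNull (M.marginal o S hS)
    {p | Q (Val.merge hR (p.2, p.1)) ≠ Q' (Val.merge hR (p.2, p.1))}

/-- A kernel that depends on the variables in `R`, read as a kernel on the copies of these
variables in a soft intervention model. -/
noncomputable def ProbabilityTheory.Kernel.lift {N : Type*} {𝒳 : N → Type*}
    [∀ v, MeasurableSpace (𝒳 v)] {R : Set N} {Y : Type*} [MeasurableSpace Y]
    (Q : Kernel (Val 𝒳 R) Y) : Kernel (Val (SoftSpace 𝒳) (Sum.inl '' R)) Y :=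
  Q.comap (Val.unlift fun _ hv => Set.mem_image_of_mem _ hv) (Val.measurable_unlift _)

/-! All three rules come from one global Markov property, `CausalBN.transCI_joint`. If `A` is
σ-separated from `B` given `S` in the latent projection, which includes separation from the input
nodes, then one kernel from values on `S` to values on `A` is the conditional law of `X_A` given
`X_S` and `X_B`, whatever the input value.

The combinatorial half works in the graph before projection. `Reach` collects the nodes joined to an
input or to `B` by an open walk of directed edges. Contracting latent paths turns such a walk into
an open walk of the projection (`Reach.reachMarginal`), so no node of `A` is reached. Among the
ancestors of `A ∪ B ∪ S`, let `R` be the reached nodes outside `S` and `P` the unreached ones. The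
parents of a node never meet both `P` and `R`, since a walk through one parent can be continued to
all the others. Hence every factor of the joint kernel that belongs to these nodes involves only `P
∪ S` or only `R ∪ S` (`SigmaSep.exists_isSeparation`).

The analytic half follows a topological order and maintains a kernel `Q`, free of the input, giving
the law of `X_P` from `X_S` alone (`CausalBN.transCI_productKernel`). A factor in `R ∪ S` is
independent of `X_P` given the past of `R ∪ S`, and a new variable in `P` is composed onto `Q`. The
delicate case is a new variable in `S` with parents in `P ∪ S`: there `Q` is replaced by a
disintegration, which needs standard Borel spaces. As `P` contains no input node, `Q` never depends
on the input value.

For the rules about actions, the property is applied to the network with soft interventions, where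
the nodes `I_B` are inputs. Imposing values on `B₂` and `⋆` on the rest of `B` reproduces the hard
intervention on `B₂` (`CausalBN.lintegral_joint_soft`), so a single kernel serves every choice of
`B₂`. Conversely, each input value of the soft network determines such a `B₂`, and almost sure
uniqueness there (`CausalBN.IsVersion.ae_eq`) yields uniqueness up to a null set of the soft
network. -/

namespace CDMG

variable {N : Type*} {G : CDMG N}

/-! ### Open walks -/

/-- The first edge of the walk has an arrow head at the first node. -/
def Walk.HeadAtStart {G : CDMG N} : {a b : N} → G.Walk a b → Prop
  | _, _, .nil _ _ => False
  | _, _, .cons e _ _ => e.HeadAtStart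

/-- A walk remains open when it is extended by an edge such that its old start node is
a collider in `S` or a non-collider outside of `S`. -/
theorem Walk.not_innerBlocked_cons {S : Set N} {v w b : N} {e : EdgeKind}
    (he : G.HasEdge e w v) {p : G.Walk v b} (hp : ¬ p.InnerBlocked S)
    (hv : v ∈ S ↔ e.HeadAtEnd ∧ p.HeadAtStart) :
    ¬ (Walk.cons e he p).InnerBlocked S := by
  cases p with
  | nil => exact id
  | cons e' h' q =>
    simp only [Walk.HeadAtStart] at hv
    simp only [Walk.InnerBlocked, not_or]
    refine ⟨?_, hp⟩
    -- For `v ∈ S` the node is a collider, and the collider clause blocks only outside of `S`. For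
    -- `v ∉ S` only that clause could block, and `hv` excludes a collider. Strongly connected
    -- components play no role.
    by_cases hS : v ∈ S
    · obtain ⟨h₁, h₂⟩ := hv.1 hS
      simp only [EdgeKind.HeadAtEnd, EdgeKind.HeadAtStart] at h₁ h₂
      rcases h₁ with rfl | rfl <;> rcases h₂ with rfl | rfl <;>
        simp [BlockedAt, hS]
    · simp only [BlockedAt, hS, false_and, and_false, not_false_eq_true, and_true, false_or]
      exact fun h => hS (hv.2 h)

/-- There is an open walk given `S` from `v` to a node in `T \ S`; the flag says whether its first
edge has an arrow head at `v`. -/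
def OpenWalk (G : CDMG N) (T S : Set N) (h : Prop) (v : N) : Prop :=
  ∃ b ∈ T, b ∉ S ∧ ∃ p : G.Walk v b, ¬ p.InnerBlocked S ∧ (p.HeadAtStart ↔ h)

/-- The flag is all that an extension must remember of a walk: together with the new edge it decides
whether `v` becomes a collider. -/
theorem OpenWalk.cons {T S : Set N} {v w : N} {h : Prop} (e : EdgeKind) (he : G.HasEdge e w v)
    (hp : G.OpenWalk T S h v) (hv : v ∈ S ↔ e.HeadAtEnd ∧ h) :
    G.OpenWalk T S e.HeadAtStart w := by
  obtain ⟨b, hb, hbS, p, hp, hh⟩ := hp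
  exact ⟨b, hb, hbS, .cons e he p, Walk.not_innerBlocked_cons he hp (by rw [hv, hh]), Iff.rfl⟩

theorem SigmaSep.not_openWalk {A B S : Set N} (hsep : G.SigmaSep A B S) {a : N} (ha : a ∈ A)
    (haS : a ∉ S) (h : Prop) : ¬ G.OpenWalk (G.J ∪ B) S h a := by
  rintro ⟨b, hb, hbS, p, hp, -⟩
  rcases hsep a ha b hb p with h | h | h
  exacts [haS h, hbS h, hp h]

/-- The nodes from which a node of `T` can be reached by an open walk that uses directed edges
only; the flag says whether the first edge has an arrow head at the start node. -/
inductive Reach (G : CDMG N) (T S : Set N) : Bool → N → Prop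
  | start {v : N} (hv : v ∈ T) (hS : v ∉ S) : Reach G T S false v
  | up {v w : N} (h : Reach G T S false v) (hv : v ∉ S) (e : G.E w v) : Reach G T S false w
  | collider {v w : N} (h : Reach G T S true v) (hv : v ∈ S) (e : G.E w v) : Reach G T S false w
  | down {b : Bool} {v w : N} (h : Reach G T S b v) (hv : v ∉ S) (e : G.E v w) :
      Reach G T S true w

/-! ### Contracting latent paths: open walks pass to the latent projection. -/

theorem DirThrough.snoc {U : Set N} {u v w : N} (h : G.DirThrough U u v) (hv : v ∈ U)
    (e : G.E v w) : G.DirThrough U u w := by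
  induction h with
  | edge h => exact .cons h hv (.edge e)
  | cons h hw _ ih => exact .cons h hw (ih hv e)

theorem DirThrough.source_mem {U : Set N} {u v : N} (h : G.DirThrough U u v) : u ∈ G.J ∪ G.V := by
  cases h with
  | edge h => exact G.E_source h
  | cons h _ _ => exact G.E_source h

theorem DirThrough.target_mem {U : Set N} {u v : N} (h : G.DirThrough U u v) : v ∈ G.V := by
  induction h with
  | edge h => exact G.E_target h
  | cons _ _ _ ih => exact ih

/-- An edge with an arrow head at `o` extends some open walk from `o`. -/
def HeadExtends (G : CDMG N) (T S : Set N) (o : N) : Prop :=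
  ∃ h : Prop, G.OpenWalk T S h o ∧ (o ∈ S ↔ h)

/-- An edge with a tail at `o` extends some open walk from `o`. -/
def TailExtends (G : CDMG N) (T S : Set N) (o : N) : Prop :=
  o ∉ S ∧ ∃ h : Prop, G.OpenWalk T S h o

/-- What an open walk from `v` in the graph says about the marginalized graph. -/
def ReachMarginal (G : CDMG N) (U T S : Set N) : Bool → N → Prop
  | false, v => (v ∉ U → (G.marginalize U).OpenWalk T S False v) ∧
      (v ∈ U → ∃ o, o ∉ U ∧ G.DirThrough U v o ∧ (G.marginalize U).HeadExtends T S o)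
  | true, v => (v ∉ U → (G.marginalize U).OpenWalk T S True v ∨
        (v ∉ S ∧ (G.marginalize U).OpenWalk T S False v)) ∧
      (v ∈ U → (∃ o, o ∉ U ∧ G.DirThrough U o v ∧ (G.marginalize U).TailExtends T S o) ∨
        ∃ u ∈ U, ∃ o, o ∉ U ∧ G.DirThrough U u v ∧ G.DirThrough U u o ∧
          (G.marginalize U).HeadExtends T S o)

section

variable {U T S : Set N}

theorem mem_marginalize {v : N} (hv : v ∈ G.J ∪ G.V) (hvU : v ∉ U) :
    v ∈ (G.marginalize U).J ∪ (G.marginalize U).V :=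
  hv.imp id fun h => ⟨h, hvU⟩

/-- If `w` is observed, the latent path contracts to an edge of the projection; if `w` is latent,
the path is stored until an observed node comes. -/
theorem reachMarginal_up {w o : N} (h : G.DirThrough U w o) (ho : o ∉ U)
    (he : (G.marginalize U).HeadExtends T S o) : G.ReachMarginal U T S false w := by
  refine ⟨fun hw => ?_, fun _ => ⟨o, ho, h, he⟩⟩
  obtain ⟨h', hp, hS⟩ := he
  have hE : (G.marginalize U).E w o :=
    ⟨h.source_mem.imp id fun h => ⟨h, hw⟩, ⟨h.target_mem, ho⟩, h⟩
  have := hp.cons .fwd hE (by simp [EdgeKind.HeadAtEnd, hS])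
  simpa [EdgeKind.HeadAtStart] using this

theorem reachMarginal_down {w o : N} (h : G.DirThrough U o w) (ho : o ∉ U)
    (he : (G.marginalize U).TailExtends T S o) : G.ReachMarginal U T S true w := by
  refine ⟨fun hw => Or.inl ?_, fun _ => Or.inl ⟨o, ho, h, he⟩⟩
  obtain ⟨hS, h', hp⟩ := he
  have hE : (G.marginalize U).E o w :=
    ⟨h.source_mem.imp id fun h => ⟨h, ho⟩, ⟨h.target_mem, hw⟩, h⟩
  have := hp.cons .bwd hE (by simp [EdgeKind.HeadAtEnd, hS])
  simpa [EdgeKind.HeadAtStart] using this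

/-- The two branches of the fork contract to `w ↔ o`. For `w = o` there is no such edge, so the
detour `w ← u → w` is deleted. The remaining walk may then lack an arrow head at `w`, but in that
case `w ∉ S`; this is the second alternative for observed nodes in `ReachMarginal`. -/
theorem reachMarginal_fork {u w o : N} (hu : u ∈ U) (hw : G.DirThrough U u w)
    (hO : G.DirThrough U u o) (ho : o ∉ U)
    (he : (G.marginalize U).HeadExtends T S o) : G.ReachMarginal U T S true w := by
  refine ⟨fun hwU => ?_, fun _ => Or.inr ⟨u, hu, o, ho, hw, hO, he⟩⟩
  obtain ⟨h', hp, hS⟩ := he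
  by_cases hwo : w = o
  · subst hwo
    by_cases h : h'
    · exact Or.inl (by simpa [h] using hp)
    · exact Or.inr ⟨by rwa [hS], by simpa [h] using hp⟩
  · have hL : (G.marginalize U).L w o :=
      ⟨⟨hw.target_mem, hwU⟩, ⟨hO.target_mem, ho⟩, hwo, Or.inl ⟨u, hu, hw, hO⟩⟩
    have := hp.cons .bi hL (by simp [EdgeKind.HeadAtEnd, hS])
    exact Or.inl (by simpa [EdgeKind.HeadAtStart] using this)

/-- End nodes lie in `T` and colliders in `S`, so both are observed. A latent node is thus inside a
directed path or the top of a fork, and these are exactly the pieces that the projection contracts.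
-/
theorem Reach.reachMarginal (hT : T ⊆ G.J ∪ G.V) (hTU : Disjoint T U)
    (hSU : Disjoint S U) {b : Bool} {v : N} (h : G.Reach T S b v) :
    G.ReachMarginal U T S b v := by
  induction h with
  | @start v hv hS =>
    have hvU : v ∉ U := Set.disjoint_left.1 hTU hv
    exact ⟨fun _ => ⟨v, hv, hS, .nil v (mem_marginalize (hT hv) hvU), id, Iff.rfl⟩,
      fun h => absurd h hvU⟩
  | @up v w _ hv e ih =>
    by_cases hvU : v ∈ U
    · obtain ⟨o, ho, hvo, he⟩ := ih.2 hvU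
      exact reachMarginal_up (.cons e hvU hvo) ho he
    · exact reachMarginal_up (.edge e) hvU ⟨False, ih.1 hvU, by simpa using hv⟩
  | @collider v w _ hv e ih =>
    have hvU : v ∉ U := Set.disjoint_left.1 hSU hv
    rcases ih.1 hvU with h | h
    · exact reachMarginal_up (.edge e) hvU ⟨True, h, by simpa using hv⟩
    · exact absurd hv h.1
  | @down b v w _ hv e ih =>
    by_cases hvU : v ∈ U
    · cases b with
      | false =>
        obtain ⟨o, ho, hvo, he⟩ := ih.2 hvU
        exact reachMarginal_fork hvU (.edge e) hvo ho he
      | true =>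
        rcases ih.2 hvU with ⟨o, ho, hvo, he⟩ | ⟨u, hu, o, ho, huv, huo, he⟩
        · exact reachMarginal_down (hvo.snoc hvU e) ho he
        · exact reachMarginal_fork hu (huv.snoc hvU e) huo ho he
    · refine reachMarginal_down (.edge e) hvU ⟨hv, ?_⟩
      cases b with
      | false => exact ⟨_, ih.1 hvU⟩
      | true =>
        rcases ih.1 hvU with h | h
        exacts [⟨_, h⟩, ⟨_, h.2⟩]

end

/-! ### Separating partitions -/

/-- The sets `P`, `R` and `S` partition a set of nodes that contains all parents of its members,
such that every node is together with its parents in `P ∪ S` or in `R ∪ S`. -/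
structure IsSeparation (G : CDMG N) (P R S : Set N) : Prop where
  disjoint_PR : Disjoint P R
  disjoint_PS : Disjoint P S
  disjoint_RS : Disjoint R S
  family : ∀ v ∈ P ∪ R ∪ S, (v ∉ R ∧ G.Pa v ⊆ P ∪ S) ∨ (v ∉ P ∧ G.Pa v ⊆ R ∪ S)

/-- If a node has a descendant in `S`, then an open walk which starts with an arrow head can be
extended to a parent. -/
theorem Reach.up_of_anc {T S : Set N} {v s : N} (hs : s ∈ S)
    (hvs : Relation.ReflTransGen G.E v s) :
    ∀ b, G.Reach T S b v → (b = false → v ∉ S) → ∀ w, G.E w v → G.Reach T S false w := by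
  induction hvs using Relation.ReflTransGen.head_induction_on with
  | refl =>
    intro b h hb w e
    cases b with
    | false => exact absurd hs (hb rfl)
    | true => exact h.collider hs e
  | @head v v' hv _ ih =>
    intro b h hb w e
    by_cases hvS : v ∈ S
    · cases b with
      | false => exact absurd hvS (hb rfl)
      | true => exact h.collider hvS e
    · exact (ih true (h.down hvS hv) (by simp) v hv).up hvS e

/-- The directed walk itself is open: it has no colliders, and all its nodes are descendants of `v`,
hence outside of `S`. -/
theorem reach_of_anc {T S : Set N} {v t : N} (hvt : Relation.ReflTransGen G.E v t) (ht : t ∈ T)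
    (hS : ∀ s ∈ S, ¬ Relation.ReflTransGen G.E v s) : G.Reach T S false v := by
  induction hvt using Relation.ReflTransGen.head_induction_on with
  | refl => exact .start ht fun h => hS _ h .refl
  | @head v v' hv _ ih =>
    have hS' : ∀ s ∈ S, ¬ Relation.ReflTransGen G.E v' s := fun s hs h => hS s hs (.head hv h)
    exact (ih hS').up (fun h => hS' _ h .refl) hv

theorem Reach.desc {T S : Set N} {v a : N} {b : Bool} (h : G.Reach T S b v)
    (hva : Relation.ReflTransGen G.E v a) (hS : ∀ s ∈ S, ¬ Relation.ReflTransGen G.E v s) :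
    ∃ b, G.Reach T S b a := by
  induction hva using Relation.ReflTransGen.head_induction_on generalizing b with
  | refl => exact ⟨b, h⟩
  | @head v v' hv _ ih =>
    exact ih (h.down (fun h => hS _ h .refl) hv) fun s hs h => hS s hs (.head hv h)

/-- σ-separation in a latent projection gives a separating partition of the nodes of the
graph. -/
theorem SigmaSep.exists_isSeparation {U A B S : Set N} (hU : U ⊆ G.V)
    (hB : B ⊆ G.V \ U) (hA : A ⊆ G.V \ U) (hSU : Disjoint S U) (hAS : Disjoint A S)
    (hBS : Disjoint B S) (hsep : (G.marginalize U).SigmaSep A B S) :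
    ∃ P R : Set N, G.IsSeparation P R S ∧ A ⊆ P ∧ B ⊆ R ∧ Disjoint P G.J := by
  set T := G.J ∪ B
  have hT : T ⊆ G.J ∪ G.V := Set.union_subset_union_right _ (hB.trans Set.sdiff_subset)
  have hTU : Disjoint T U := by
    rw [Set.disjoint_left]
    rintro v (hv | hv) hvU
    · exact Set.disjoint_left.1 G.disj hv (hU hvU)
    · exact (hB hv).2 hvU
  have hnot : ∀ a ∈ A, ∀ b, ¬ G.Reach T S b a := by
    intro a ha b h
    have haS := Set.disjoint_left.1 hAS ha
    have haU := (hA ha).2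
    have hr := h.reachMarginal hT hTU hSU
    cases b with
    | false => exact hsep.not_openWalk ha haS _ (hr.1 haU)
    | true =>
      rcases hr.1 haU with h | h
      exacts [hsep.not_openWalk ha haS _ h, hsep.not_openWalk ha haS _ h.2]
  -- Only ancestors matter: nodes outside `Z` can be integrated out and would spoil the partition.
  let Z : Set N := {z | ∃ y ∈ A ∪ B ∪ S, Relation.ReflTransGen G.E z y}
  have hZ : ∀ v ∈ Z, ∀ w, G.E w v → w ∈ Z := fun v ⟨y, hy, h⟩ w e => ⟨y, hy, .head e h⟩
  have hsub : A ∪ B ∪ S ⊆ Z := fun v hv => ⟨v, hv, .refl⟩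
  -- A walk arriving at `v` with an arrow head cannot simply go on to a parent. A descendant in `S`
  -- serves as turning point. Otherwise a descendant in `B` starts a fresh walk upwards through `v`,
  -- while one in `A` would be reached, contrary to separation.
  have hup : ∀ v ∈ Z, v ∉ S → ∀ b, G.Reach T S b v → ∀ w, G.E w v → G.Reach T S false w := by
    rintro v ⟨y, hy, hvy⟩ hvS b h w e
    by_cases hs : ∃ s ∈ S, Relation.ReflTransGen G.E v s
    · obtain ⟨s, hs, hvs⟩ := hs
      exact h.up_of_anc hs hvs b (fun _ => hvS) w e
    · push Not at hs
      rcases hy with (hy | hy) | hy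
      · obtain ⟨b', h'⟩ := h.desc hvy hs
        exact absurd h' (hnot y hy b')
      · exact (reach_of_anc hvy (Or.inr hy) hs).up hvS e
      · exact absurd hvy (hs y hy)
  let R : Set N := {v | v ∈ Z ∧ v ∉ S ∧ ∃ b, G.Reach T S b v}
  refine ⟨Z \ (S ∪ R), R, ⟨?_, ?_, ?_, ?_⟩, ?_, ?_, ?_⟩
  · exact Set.disjoint_left.2 fun v hv hv' => hv.2 (Or.inr hv')
  · exact Set.disjoint_left.2 fun v hv hv' => hv.2 (Or.inl hv')
  · exact Set.disjoint_left.2 fun v hv hv' => hv.2.1 hv'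
  · intro v hv
    have hvZ : v ∈ Z := by
      rcases hv with (hv | hv) | hv
      exacts [hv.1, hv.1, hsub (Or.inr hv)]
    by_cases hex : v ∈ R ∨ ∃ u ∈ G.Pa v, u ∈ R
    · right
      -- One reached member of the family propagates to all parents: if `v ∈ S` it is an open
      -- collider between two parents, and otherwise `v` is reached itself and `hup` applies.
      have hr : ∀ w ∈ G.Pa v, G.Reach T S false w := by
        intro w hw
        by_cases hvS : v ∈ S
        · rcases hex with h | ⟨u, hu, -, huS, b, h⟩
          · exact absurd hvS h.2.1
          · exact (h.down huS hu).collider hvS hw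
        · rcases hex with ⟨-, -, b, h⟩ | ⟨u, hu, -, huS, b, h⟩
          · exact hup v hvZ hvS b h w hw
          · exact hup v hvZ hvS true (h.down huS hu) w hw
      refine ⟨fun hvP => ?_, fun w hw => ?_⟩
      · rcases hex with h | ⟨u, hu, -, huS, b, h⟩
        · exact hvP.2 (Or.inr h)
        · exact hvP.2 (Or.inr ⟨hvZ, fun h => hvP.2 (Or.inl h), true, h.down huS hu⟩)
      · by_cases hwS : w ∈ S
        · exact Or.inr hwS
        · exact Or.inl ⟨hZ v hvZ w hw, hwS, false, hr w hw⟩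
    · push Not at hex
      refine Or.inl ⟨hex.1, fun w hw => ?_⟩
      by_cases hwS : w ∈ S
      · exact Or.inr hwS
      · exact Or.inl ⟨hZ v hvZ w hw, fun h => h.elim hwS (hex.2 w hw)⟩
  · intro a ha
    refine ⟨hsub (Or.inl (Or.inl ha)), ?_⟩
    rintro (h | ⟨-, -, b, h⟩)
    · exact Set.disjoint_left.1 hAS ha h
    · exact hnot a ha b h
  · intro b hb
    have hbS := Set.disjoint_left.1 hBS hb
    exact ⟨hsub (Or.inl (Or.inr hb)), hbS, false, .start (Or.inr hb) hbS⟩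
  · refine Set.disjoint_left.2 fun v hv hvJ => hv.2 ?_
    by_cases hvS : v ∈ S
    · exact Or.inl hvS
    · exact Or.inr ⟨hv.1, hvS, false, .start (Or.inl hvJ) hvS⟩

end CDMG

/-! ### Transitional conditional independence -/

section TransCI

open scoped ENNReal

variable {τ Ω Ω' α α' β β' γ γ' δ : Type*} [MeasurableSpace Ω] [MeasurableSpace Ω']
  [MeasurableSpace α] [MeasurableSpace α'] [MeasurableSpace β] [MeasurableSpace β']
  [MeasurableSpace γ] [MeasurableSpace γ'] [MeasurableSpace δ]

/-- A Markov kernel disintegrates if the target is standard, even if it is empty. -/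
theorem exists_isMarkovKernel_isCondKernel [MeasurableSpace.CountablyGenerated δ]
    [StandardBorelSpace γ] (κ : Kernel α (δ × γ)) [IsMarkovKernel κ] :
    ∃ η : Kernel (α × δ) γ, IsMarkovKernel η ∧ κ.fst ⊗ₖ η = κ := by
  rcases isEmpty_or_nonempty γ with hγ | hγ
  -- A probability measure on an empty space is impossible, so the source is empty as well.
  · have : IsEmpty α := ⟨fun a => by
      obtain ⟨p⟩ := nonempty_of_isProbabilityMeasure (κ a)
      exact hγ.elim p.2⟩
    exact ⟨0, ⟨fun p => isEmptyElim p.1⟩, by ext a; exact isEmptyElim a⟩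
  · exact ⟨κ.condKernel, inferInstance, κ.disintegrate _⟩

/-- Transitional conditional independence of `W` from `Y` and the parameter, given `X`: there is
a Markov kernel that is a version of the conditional kernel of `W` given `(X, Y)` for all values
of the parameter. -/
def TransCI (μ : τ → Measure Ω) (X : τ → Ω → α) (Y : τ → Ω → β) (W : τ → Ω → γ) : Prop :=
  ∃ Q : Kernel α γ, IsMarkovKernel Q ∧ ∀ t, ∀ f : α × β × γ → ℝ≥0∞, Measurable f →
    ∫⁻ ω, f (X t ω, Y t ω, W t ω) ∂μ t = ∫⁻ ω, ∫⁻ p, f (X t ω, Y t ω, p) ∂Q (X t ω) ∂μ t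

variable {μ : τ → Measure Ω} {μ' : τ → Measure Ω'} {X : τ → Ω → α} {Y : τ → Ω → β}
  {W : τ → Ω → γ} {X' : τ → Ω' → α'} {Y' : τ → Ω' → β'} {W' : τ → Ω' → γ'} {c : Ω × δ → Ω'}
  {π : α' → α}

theorem measurable_lintegral_kernel {Q : Kernel α γ} [IsMarkovKernel Q] {f : δ × γ → ℝ≥0∞}
    (hf : Measurable f) {g : δ → α} (hg : Measurable g) :
    Measurable fun d => ∫⁻ p, f (d, p) ∂Q (g d) := by
  have := Measurable.lintegral_kernel_prod_right' (κ := Q.comap g hg) (f := f) hf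
  simpa [Kernel.comap_apply] using this

/-- A step to a new variable that does not affect any of the others. -/
theorem TransCI.step_skip (h : TransCI μ X Y W) {κ : τ → Ω → Measure δ}
    (hκ : ∀ t ω, IsProbabilityMeasure (κ t ω))
    (hμ : ∀ t, ∀ g : Ω' → ℝ≥0∞, Measurable g →
      ∫⁻ ω, g ω ∂μ' t = ∫⁻ ω, ∫⁻ y, g (c (ω, y)) ∂κ t ω ∂μ t)
    {φ : α → α'} {ψ : τ → β → β'} {χ : γ → γ'}
    (hφ : Measurable φ) (hψ : ∀ t, Measurable (ψ t)) (hχ : Measurable χ)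
    (hπ : Measurable π) (hπφ : ∀ x, π (φ x) = x)
    (hX' : ∀ t, Measurable (X' t)) (hY' : ∀ t, Measurable (Y' t)) (hW' : ∀ t, Measurable (W' t))
    (hX : ∀ t ω y, X' t (c (ω, y)) = φ (X t ω)) (hY : ∀ t ω y, Y' t (c (ω, y)) = ψ t (Y t ω))
    (hW : ∀ t ω y, W' t (c (ω, y)) = χ (W t ω)) : TransCI μ' X' Y' W' := by
  obtain ⟨Q, hQ, h⟩ := h
  have hQ' : IsMarkovKernel ((Q.comap π hπ).map χ) := Kernel.IsMarkovKernel.map _ hχ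
  refine ⟨(Q.comap π hπ).map χ, hQ', fun t f hf => ?_⟩
  have hm := measurable_lintegral_kernel (Q := (Q.comap π hπ).map χ) (f := fun p : Ω' × γ' =>
    f (X' t p.1, Y' t p.1, p.2)) (by have := hX' t; have := hY' t; fun_prop) (hX' t)
  rw [hμ t _ (by have := hX' t; have := hY' t; have := hW' t; fun_prop), hμ t _ hm]
  simp only [hX, hY, hW, lintegral_const, measure_univ, mul_one, Kernel.map_apply _ hχ,
    Kernel.comap_apply, hπφ]
  have hψ' := hψ t
  have := h t (fun p => f (φ p.1, ψ t p.2.1, χ p.2.2)) (by fun_prop)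
  rw [this]
  refine lintegral_congr fun ω => ?_
  rw [lintegral_map (by fun_prop) hχ]

/-- A step to a new variable, depending on `X` and `Y`, that is added to `X` or `Y`. -/
theorem TransCI.step_right (h : TransCI μ X Y W) (κ : τ → Kernel (α × β) δ)
    (hκ : ∀ t, IsMarkovKernel (κ t))
    (hμ : ∀ t, ∀ g : Ω' → ℝ≥0∞, Measurable g →
      ∫⁻ ω, g ω ∂μ' t = ∫⁻ ω, ∫⁻ y, g (c (ω, y)) ∂κ t (X t ω, Y t ω) ∂μ t)
    {φ : α × δ → α'} {ψ : τ → β × δ → β'} {χ : γ → γ'}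
    (hφ : Measurable φ) (hψ : ∀ t, Measurable (ψ t)) (hχ : Measurable χ)
    (hπ : Measurable π) (hπφ : ∀ x y, π (φ (x, y)) = x)
    (hX' : ∀ t, Measurable (X' t)) (hY' : ∀ t, Measurable (Y' t)) (hW' : ∀ t, Measurable (W' t))
    (hX : ∀ t ω y, X' t (c (ω, y)) = φ (X t ω, y))
    (hY : ∀ t ω y, Y' t (c (ω, y)) = ψ t (Y t ω, y))
    (hW : ∀ t ω y, W' t (c (ω, y)) = χ (W t ω)) : TransCI μ' X' Y' W' := by
  obtain ⟨Q, hQ, h⟩ := h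
  have hQ' : IsMarkovKernel ((Q.comap π hπ).map χ) := Kernel.IsMarkovKernel.map _ hχ
  refine ⟨(Q.comap π hπ).map χ, hQ', fun t f hf => ?_⟩
  have := hκ t
  have hψ' := hψ t
  have hm := measurable_lintegral_kernel (Q := (Q.comap π hπ).map χ) (f := fun p : Ω' × γ' =>
    f (X' t p.1, Y' t p.1, p.2)) (by have := hX' t; have := hY' t; fun_prop) (hX' t)
  rw [hμ t _ (by have := hX' t; have := hY' t; have := hW' t; fun_prop), hμ t _ hm]
  simp only [hX, hY, hW, Kernel.map_apply _ hχ, Kernel.comap_apply, hπφ]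
  have hF : Measurable fun p : α × β × γ =>
      ∫⁻ y, f (φ (p.1, y), ψ t (p.2.1, y), χ p.2.2) ∂κ t (p.1, p.2.1) :=
    measurable_lintegral_kernel (f := fun q : (α × β × γ) × δ =>
      f (φ (q.1.1, q.2), ψ t (q.1.2.1, q.2), χ q.1.2.2)) (by fun_prop) (by fun_prop)
  rw [h t _ hF]
  refine lintegral_congr fun ω => ?_
  -- Given `X` and `Y`, the law of the new variable ignores `W` and `Q` ignores the new variable, so
  -- the two integrations commute.
  refine (lintegral_lintegral_swap (μ := Q (X t ω)) (ν := κ t (X t ω, Y t ω))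
    (f := fun p y => f (φ (X t ω, y), ψ t (Y t ω, y), χ p)) (by fun_prop)).trans ?_
  refine lintegral_congr fun y => ?_
  rw [lintegral_map (by fun_prop) hχ]

/-- A step to a new variable, depending on `X` and `W`, that is added to `W`. -/
theorem TransCI.step_left (h : TransCI μ X Y W) (κ : Kernel (α × γ) δ) [IsMarkovKernel κ]
    (hμ : ∀ t, ∀ g : Ω' → ℝ≥0∞, Measurable g →
      ∫⁻ ω, g ω ∂μ' t = ∫⁻ ω, ∫⁻ y, g (c (ω, y)) ∂κ (X t ω, W t ω) ∂μ t)
    {φ : α → α'} {ψ : τ → β → β'} {χ : γ × δ → γ'}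
    (hφ : Measurable φ) (hψ : ∀ t, Measurable (ψ t)) (hχ : Measurable χ)
    (hπ : Measurable π) (hπφ : ∀ x, π (φ x) = x)
    (hX' : ∀ t, Measurable (X' t)) (hY' : ∀ t, Measurable (Y' t)) (hW' : ∀ t, Measurable (W' t))
    (hX : ∀ t ω y, X' t (c (ω, y)) = φ (X t ω))
    (hY : ∀ t ω y, Y' t (c (ω, y)) = ψ t (Y t ω))
    (hW : ∀ t ω y, W' t (c (ω, y)) = χ (W t ω, y)) : TransCI μ' X' Y' W' := by
  obtain ⟨Q, hQ, h⟩ := h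
  have hQ' : IsMarkovKernel (((Q ⊗ₖ κ).comap π hπ).map χ) := Kernel.IsMarkovKernel.map _ hχ
  refine ⟨((Q ⊗ₖ κ).comap π hπ).map χ, hQ', fun t f hf => ?_⟩
  have hψ' := hψ t
  have hm := measurable_lintegral_kernel (Q := ((Q ⊗ₖ κ).comap π hπ).map χ)
    (f := fun p : Ω' × γ' => f (X' t p.1, Y' t p.1, p.2))
    (by have := hX' t; have := hY' t; fun_prop) (hX' t)
  rw [hμ t _ (by have := hX' t; have := hY' t; have := hW' t; fun_prop), hμ t _ hm]
  simp only [hX, hY, hW, Kernel.map_apply _ hχ, Kernel.comap_apply, hπφ, lintegral_const,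
    measure_univ, mul_one]
  have hF : Measurable fun p : α × β × γ =>
      ∫⁻ y, f (φ p.1, ψ t p.2.1, χ (p.2.2, y)) ∂κ (p.1, p.2.2) :=
    measurable_lintegral_kernel (f := fun q : (α × β × γ) × δ =>
      f (φ q.1.1, ψ t q.1.2.1, χ (q.1.2.2, q.2))) (by fun_prop) (by fun_prop)
  rw [h t _ hF]
  refine lintegral_congr fun ω => ?_
  rw [lintegral_map (by fun_prop) hχ, Kernel.lintegral_compProd _ _ _ (by fun_prop)]

/-- A step to a new variable, depending on `X` and `W`, that is added to `X`. -/
theorem TransCI.step_left_cond [MeasurableSpace.CountablyGenerated δ] [StandardBorelSpace γ]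
    (h : TransCI μ X Y W) (κ : Kernel (α × γ) δ) [IsMarkovKernel κ]
    (hμ : ∀ t, ∀ g : Ω' → ℝ≥0∞, Measurable g →
      ∫⁻ ω, g ω ∂μ' t = ∫⁻ ω, ∫⁻ y, g (c (ω, y)) ∂κ (X t ω, W t ω) ∂μ t)
    {φ : α × δ → α'} {ψ : τ → β → β'} {χ : γ → γ'} {π : α' → α × δ}
    (hφ : Measurable φ) (hψ : ∀ t, Measurable (ψ t)) (hχ : Measurable χ)
    (hπ : Measurable π) (hπφ : ∀ p, π (φ p) = p)
    (hX' : ∀ t, Measurable (X' t)) (hY' : ∀ t, Measurable (Y' t)) (hW' : ∀ t, Measurable (W' t))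
    (hX : ∀ t ω y, X' t (c (ω, y)) = φ (X t ω, y))
    (hY : ∀ t ω y, Y' t (c (ω, y)) = ψ t (Y t ω))
    (hW : ∀ t ω y, W' t (c (ω, y)) = χ (W t ω)) : TransCI μ' X' Y' W' := by
  obtain ⟨Q, hQ, h⟩ := h
  -- This is the joint law of the new variable and `W` given the old `X`. Its disintegration `η`
  -- over the new variable replaces `Q`.
  let ρ : Kernel α (δ × γ) := (Q ⊗ₖ κ).map Prod.swap
  have hρm : IsMarkovKernel ρ := Kernel.IsMarkovKernel.map _ measurable_swap
  obtain ⟨η, hη, hρ⟩ := exists_isMarkovKernel_isCondKernel ρ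
  have hρint : ∀ x, ∀ g : γ × δ → ℝ≥0∞, Measurable g →
      ∫⁻ w, ∫⁻ y, g (w, y) ∂κ (x, w) ∂Q x = ∫⁻ y, ∫⁻ w, g (w, y) ∂η (x, y) ∂ρ.fst x := by
    intro x g hg
    have h₁ : ∫⁻ p, g p.swap ∂ρ x = ∫⁻ w, ∫⁻ y, g (w, y) ∂κ (x, w) ∂Q x := by
      rw [Kernel.lintegral_map _ measurable_swap _ (by fun_prop)]
      simp only [Prod.swap_swap]
      rw [Kernel.lintegral_compProd _ _ _ hg]
    rw [← h₁, ← hρ, Kernel.lintegral_compProd _ _ _ (by fun_prop), hρ]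
    rfl
  have hQ' : IsMarkovKernel ((η.comap π hπ).map χ) := Kernel.IsMarkovKernel.map _ hχ
  refine ⟨(η.comap π hπ).map χ, hQ', fun t f hf => ?_⟩
  have hψ' := hψ t
  have hm := measurable_lintegral_kernel (Q := (η.comap π hπ).map χ)
    (f := fun p : Ω' × γ' => f (X' t p.1, Y' t p.1, p.2))
    (by have := hX' t; have := hY' t; fun_prop) (hX' t)
  rw [hμ t _ (by have := hX' t; have := hY' t; have := hW' t; fun_prop), hμ t _ hm]
  simp only [hX, hY, hW, Kernel.map_apply _ hχ, Kernel.comap_apply, hπφ]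
  have hF : Measurable fun p : α × β × γ =>
      ∫⁻ y, f (φ (p.1, y), ψ t p.2.1, χ p.2.2) ∂κ (p.1, p.2.2) :=
    measurable_lintegral_kernel (f := fun q : (α × β × γ) × δ =>
      f (φ (q.1.1, q.2), ψ t q.1.2.1, χ q.1.2.2)) (by fun_prop) (by fun_prop)
  have hI : Measurable fun q : (α × β) × δ =>
      ∫⁻ w, f (φ (q.1.1, q.2), ψ t q.1.2, χ w) ∂η (q.1.1, q.2) :=
    measurable_lintegral_kernel (f := fun q : ((α × β) × δ) × γ =>
      f (φ (q.1.1.1, q.1.2), ψ t q.1.1.2, χ q.2)) (by fun_prop) (by fun_prop)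
  have hF' : Measurable fun p : α × β × γ =>
      ∫⁻ y, ∫⁻ w, f (φ (p.1, y), ψ t p.2.1, χ w) ∂η (p.1, y) ∂κ (p.1, p.2.2) :=
    measurable_lintegral_kernel (f := fun q : (α × β × γ) × δ =>
      ∫⁻ w, f (φ (q.1.1, q.2), ψ t q.1.2.1, χ w) ∂η (q.1.1, q.2))
      (hI.comp (f := fun q : (α × β × γ) × δ => ((q.1.1, q.1.2.1), q.2)) (by fun_prop))
      (by fun_prop)
  rw [h t _ hF]
  have hR : ∀ ω, ∫⁻ y, ∫⁻ w, f (φ (X t ω, y), ψ t (Y t ω), w) ∂(η (X t ω, y)).map χ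
      ∂κ (X t ω, W t ω) =
      ∫⁻ y, ∫⁻ w, f (φ (X t ω, y), ψ t (Y t ω), χ w) ∂η (X t ω, y) ∂κ (X t ω, W t ω) :=
    fun ω => lintegral_congr fun y => lintegral_map (by fun_prop) hχ
  rw [lintegral_congr hR, h t _ hF']
  refine lintegral_congr fun ω => ?_
  -- Both sides become integrals against `ρ.fst` and `η`. On the second, the integrand no longer
  -- depends on `w`, so the extra integral over the Markov kernel `η` disappears.
  rw [hρint (X t ω) (fun p => f (φ (X t ω, p.2), ψ t (Y t ω), χ p.1)) (by fun_prop)]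
  rw [hρint (X t ω) (fun p => ∫⁻ w, f (φ (X t ω, p.2), ψ t (Y t ω), χ w) ∂η (X t ω, p.2))
    (hI.comp (f := fun p : γ × δ => ((X t ω, Y t ω), p.2)) (by fun_prop))]
  simp

end TransCI

/-! ### Coordinates of extended and merged tuples. -/

namespace Val

variable {N : Type*} {𝒳 : N → Type*}

open scoped Classical in
/-- Add a coordinate `x_v` to a tuple. -/
noncomputable def extend {T T' : Set N} (v : N) (h : T' ⊆ insert v T) (p : Val 𝒳 T × 𝒳 v) :
    Val 𝒳 T' :=
  fun w => if hw : (w : N) = v then cast (congrArg 𝒳 hw.symm) p.2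
    else p.1 ⟨w, (h w.2).resolve_left hw⟩

theorem extend_self {T T' : Set N} {v : N} (h : T' ⊆ insert v T) (x : Val 𝒳 T) (y : 𝒳 v)
    (hv : v ∈ T') : extend v h (x, y) ⟨v, hv⟩ = y := by
  simp [extend]

theorem extend_of_ne {T T' : Set N} {v w : N} (h : T' ⊆ insert v T) (x : Val 𝒳 T) (y : 𝒳 v)
    (hw : w ∈ T') (hne : w ≠ v) :
    extend v h (x, y) ⟨w, hw⟩ = x ⟨w, (h hw).resolve_left hne⟩ := by
  simp [extend, hne]

theorem cons_self {v : N} {l : List N} (x : Val 𝒳 {w | w ∈ l}) (y : 𝒳 v)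
    (hv : v ∈ {w | w ∈ v :: l}) : cons v l (x, y) ⟨v, hv⟩ = y := by
  simp [cons]

theorem cons_of_ne {v w : N} {l : List N} (x : Val 𝒳 {w | w ∈ l}) (y : 𝒳 v)
    (hw : w ∈ {w | w ∈ v :: l}) (hne : w ≠ v) :
    cons v l (x, y) ⟨w, hw⟩ = x ⟨w, (List.mem_cons.1 hw).resolve_left hne⟩ := by
  simp [cons, hne]

theorem merge_of_mem {R S T : Set N} (h : R ⊆ S ∪ T) (x : Val 𝒳 S) (y : Val 𝒳 T) {v : N}
    (hv : v ∈ R) (hS : v ∈ S) : merge h (x, y) ⟨v, hv⟩ = x ⟨v, hS⟩ := by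
  simp [merge, hS]

theorem merge_of_notMem {R S T : Set N} (h : R ⊆ S ∪ T) (x : Val 𝒳 S) (y : Val 𝒳 T) {v : N}
    (hv : v ∈ R) (hS : v ∉ S) : merge h (x, y) ⟨v, hv⟩ = y ⟨v, (h hv).resolve_left hS⟩ := by
  simp [merge, hS]

variable [∀ v, MeasurableSpace (𝒳 v)]

theorem measurable_extend {T T' : Set N} (v : N) (h : T' ⊆ insert v T) :
    Measurable (extend v h : Val 𝒳 T × 𝒳 v → Val 𝒳 T') := by
  refine measurable_pi_iff.2 fun ⟨w, hw'⟩ => ?_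
  by_cases hw : w = v
  · subst hw
    simpa [extend] using measurable_snd
  · rw [show (fun p : Val 𝒳 T × 𝒳 v => extend v h p ⟨w, hw'⟩) = fun p =>
      p.1 ⟨w, (h hw').resolve_left hw⟩ from
      funext fun p => extend_of_ne h p.1 p.2 hw' hw]
    exact (measurable_pi_apply (⟨w, (h hw').resolve_left hw⟩ : T)).comp measurable_fst

end Val

/-! ### The Markov property along a topological order. -/

namespace CDMG

variable {N : Type*} {G : CDMG N}

theorem IsOrdered.mem_V : ∀ {l : List N}, G.IsOrdered l → ∀ v ∈ l, v ∈ G.V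
  | [], _, _, h => absurd h List.not_mem_nil
  | _ :: _, hl, v, h => by
    rcases List.mem_cons.1 h with rfl | h
    exacts [hl.1, hl.2.2.2.mem_V v h]

end CDMG

namespace CausalBN

open scoped ENNReal

variable {N : Type*} {𝒳 : N → Type*} [∀ v, MeasurableSpace (𝒳 v)]

theorem lintegral_productKernel_cons (M : CausalBN 𝒳) (v : N) (l : List N)
    (h : M.G.IsOrdered (v :: l)) (t : Val 𝒳 M.G.J) {g : Val 𝒳 {w | w ∈ v :: l} → ℝ≥0∞}
    (hg : Measurable g) :
    ∫⁻ x, g x ∂M.productKernel (v :: l) h t =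
      ∫⁻ x, ∫⁻ y, g (Val.cons v l (x, y)) ∂M.kernel ⟨v, h.1⟩ (Val.merge h.2.2.1 (t, x))
        ∂M.productKernel l h.2.2.2 t := by
  have := M.productKernel_markov l h.2.2.2
  have := M.markov ⟨v, h.1⟩
  have hc := Val.measurable_cons (𝒳 := 𝒳) v l
  rw [productKernel, Kernel.lintegral_map _ hc _ hg]
  exact Kernel.lintegral_compProd _ _ _ (hg.comp hc)

/-- A separating partition gives conditional independence in all products along a topological
order. -/
theorem transCI_productKernel [Finite N] (M : CausalBN 𝒳) {P R S : Set N}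
    (hsep : M.G.IsSeparation P R S) (hPJ : Disjoint P M.G.J) :
    ∀ (l : List N) (h : M.G.IsOrdered l),
      TransCI (fun t => M.productKernel l h t)
        (fun t x => (Val.merge Set.inter_subset_right (t, x) :
          Val 𝒳 (S ∩ (M.G.J ∪ {w | w ∈ l}))))
        (fun _ x => (Val.proj Set.inter_subset_right x : Val 𝒳 (R ∩ {w | w ∈ l})))
        (fun _ x => (Val.proj Set.inter_subset_right x : Val 𝒳 (P ∩ {w | w ∈ l})))
  | [], h => by
    have : Subsingleton (Val 𝒳 (P ∩ {w | w ∈ ([] : List N)})) :=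
      ⟨fun _ _ => funext fun v => absurd v.2.2 List.not_mem_nil⟩
    -- No variable of `P` has occurred yet, so `Q` is the point mass on a one-point space.
    refine ⟨Kernel.const _ (Measure.dirac fun v => absurd v.2.2 List.not_mem_nil),
      inferInstance, fun t f _ => lintegral_congr fun x => ?_⟩
    rw [Kernel.const_apply, lintegral_dirac' _ (by fun_prop)]
    exact congrArg (fun p => f (_, _, p)) (Subsingleton.elim _ _)
  | v :: l, h => by
    have ih := M.transCI_productKernel hsep hPJ l h.2.2.2
    have hmk := M.markov ⟨v, h.1⟩
    have hvJ : v ∉ M.G.J := fun hJ => Set.disjoint_left.1 M.G.disj hJ h.1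
    have hst : ∀ w ∈ l, StandardBorelSpace (𝒳 w) := fun w hw =>
      M.standard w (h.2.2.2.mem_V w hw)
    have hstv : StandardBorelSpace (𝒳 v) := M.standard v h.1
    have hstP : StandardBorelSpace (Val 𝒳 (P ∩ {w | w ∈ l})) := by
      have : ∀ w : ↥(P ∩ {w | w ∈ l}), StandardBorelSpace (𝒳 w) := fun w => hst w w.2.2
      infer_instance
    have hint : ∀ t, ∀ g : Val 𝒳 {w | w ∈ v :: l} → ℝ≥0∞, Measurable g → _ :=
      fun t g hg => M.lintegral_productKernel_cons v l h t hg
    have hX' : ∀ t : Val 𝒳 M.G.J, Measurable fun x => (Val.merge Set.inter_subset_right (t, x) :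
        Val 𝒳 (S ∩ (M.G.J ∪ {w | w ∈ v :: l}))) :=
      fun t => (Val.measurable_merge _).comp measurable_prodMk_left
    have hproj : ∀ T : Set N, ∀ _ : Val 𝒳 M.G.J, Measurable fun x =>
        (Val.proj Set.inter_subset_right x : Val 𝒳 (T ∩ {w | w ∈ v :: l})) :=
      fun T _ => Val.measurable_proj _
    -- how the set of variables in `S` changes
    have hS₁ : S ∩ (M.G.J ∪ {w | w ∈ l}) ⊆ S ∩ (M.G.J ∪ {w | w ∈ v :: l}) := fun w hw =>
      ⟨hw.1, hw.2.imp id fun h => List.mem_cons_of_mem v h⟩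
    have hS₂ : S ∩ (M.G.J ∪ {w | w ∈ v :: l}) ⊆ insert v (S ∩ (M.G.J ∪ {w | w ∈ l})) := by
      rintro w ⟨hwS, hw | hw⟩
      · exact Or.inr ⟨hwS, Or.inl hw⟩
      · exact (List.mem_cons.1 hw).imp id fun h => ⟨hwS, Or.inr h⟩
    have hS₃ : v ∉ S → S ∩ (M.G.J ∪ {w | w ∈ v :: l}) ⊆ S ∩ (M.G.J ∪ {w | w ∈ l}) :=
      fun hv w hw => (hS₂ hw).resolve_left fun h => hv (h ▸ hw.1)
    have hT₂ : ∀ T : Set N, T ∩ {w | w ∈ v :: l} ⊆ insert v (T ∩ {w | w ∈ l}) :=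
      fun T w hw => (List.mem_cons.1 hw.2).imp id fun h => ⟨hw.1, h⟩
    have hT₃ : ∀ T : Set N, v ∉ T → T ∩ {w | w ∈ v :: l} ⊆ T ∩ {w | w ∈ l} :=
      fun T hv w hw => (hT₂ T hw).resolve_left fun h => hv (h ▸ hw.1)
    have hXin : ∀ (t : Val 𝒳 M.G.J) x y, (Val.merge Set.inter_subset_right
        (t, Val.cons v l (x, y)) : Val 𝒳 (S ∩ (M.G.J ∪ {w | w ∈ v :: l}))) =
        Val.extend v hS₂ (Val.merge Set.inter_subset_right (t, x), y) := by
      intro t x y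
      funext ⟨w, hw⟩
      by_cases hwv : w = v
      · subst hwv
        rw [Val.merge_of_notMem _ _ _ _ hvJ, Val.extend_self, Val.cons_self]
      · rw [Val.extend_of_ne _ _ _ _ hwv]
        by_cases hwJ : w ∈ M.G.J
        · rw [Val.merge_of_mem _ _ _ _ hwJ, Val.merge_of_mem _ _ _ _ hwJ]
        · rw [Val.merge_of_notMem _ _ _ _ hwJ, Val.merge_of_notMem _ _ _ _ hwJ,
            Val.cons_of_ne _ _ _ hwv]
    have hXout : ∀ (hv : v ∉ S) (t : Val 𝒳 M.G.J) x y, (Val.merge Set.inter_subset_right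
        (t, Val.cons v l (x, y)) : Val 𝒳 (S ∩ (M.G.J ∪ {w | w ∈ v :: l}))) =
        Val.proj (hS₃ hv) (Val.merge Set.inter_subset_right (t, x)) := by
      intro hv t x y
      rw [hXin]
      funext ⟨w, hw⟩
      rw [Val.extend_of_ne _ _ _ _ (ne_of_mem_of_not_mem hw.1 hv)]
      rfl
    have hTin : ∀ (T : Set N) (x : Val 𝒳 {w | w ∈ l}) y, (Val.proj Set.inter_subset_right
        (Val.cons v l (x, y)) : Val 𝒳 (T ∩ {w | w ∈ v :: l})) =
        Val.extend v (hT₂ T) (Val.proj Set.inter_subset_right x, y) := by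
      intro T x y
      funext ⟨w, hw⟩
      by_cases hwv : w = v
      · subst hwv
        rw [Val.extend_self]
        exact Val.cons_self _ _ _
      · rw [Val.extend_of_ne _ _ _ _ hwv]
        exact Val.cons_of_ne _ _ _ hwv
    have hTout : ∀ (T : Set N) (hv : v ∉ T) (x : Val 𝒳 {w | w ∈ l}) y,
        (Val.proj Set.inter_subset_right
        (Val.cons v l (x, y)) : Val 𝒳 (T ∩ {w | w ∈ v :: l})) =
        Val.proj (hT₃ T hv) (Val.proj Set.inter_subset_right x) := by
      intro T hv x y
      rw [hTin]
      funext ⟨w, hw⟩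
      rw [Val.extend_of_ne _ _ _ _ (ne_of_mem_of_not_mem hw.1 hv)]
      rfl
    by_cases hvZ : v ∈ P ∪ R ∪ S
    · rcases hsep.family v hvZ with ⟨hvR, hPa⟩ | ⟨hvP, hPa⟩
      · -- the new variable depends on the variables in `P` and `S`
        -- Since `P` avoids the inputs, the kernel at `v` sees the input value only through
        -- coordinates in `S`; this keeps `Q` free of `t`.
        have hPa' : M.G.Pa v ⊆ S ∩ (M.G.J ∪ {w | w ∈ l}) ∪ P ∩ {w | w ∈ l} := by
          intro w hw
          rcases hPa hw with hP | hS
          · exact Or.inr ⟨hP, (h.2.2.1 hw).resolve_left (Set.disjoint_left.1 hPJ hP)⟩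
          · exact Or.inl ⟨hS, h.2.2.1 hw⟩
        have hm : ∀ (t : Val 𝒳 M.G.J) (x : Val 𝒳 {w | w ∈ l}),
            Val.merge h.2.2.1 (t, x) = Val.merge hPa' (Val.merge Set.inter_subset_right (t, x),
              Val.proj Set.inter_subset_right x) := by
          intro t x
          funext ⟨w, hw⟩
          rcases hPa' hw with hS | hP
          · rw [Val.merge_of_mem hPa' _ _ _ hS]
            rfl
          · have hwS : w ∉ S := Set.disjoint_left.1 hsep.disjoint_PS hP.1
            rw [Val.merge_of_notMem hPa' _ _ _ fun h => hwS h.1,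
              Val.merge_of_notMem _ _ _ _ (Set.disjoint_left.1 hPJ hP.1)]
            rfl
        have hint' := hint
        simp only [hm] at hint'
        by_cases hvS : v ∈ S
        · have hvP : v ∉ P := fun hvP => Set.disjoint_left.1 hsep.disjoint_PS hvP hvS
          -- Here the conditioning set gains a possible effect of `X_P`, which changes the
          -- conditional law of `X_P`.
          refine ih.step_left_cond ((M.kernel ⟨v, h.1⟩).comap (Val.merge hPa')
            (Val.measurable_merge _)) (c := Val.cons v l)
            hint' (φ := Val.extend v hS₂) (ψ := fun _ => Val.proj (hT₃ R hvR))
            (χ := Val.proj (hT₃ P hvP))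
            (π := fun x => (Val.proj hS₁ x, x ⟨v, hvS, Or.inr List.mem_cons_self⟩))
            (Val.measurable_extend _ _) (fun _ => Val.measurable_proj _) (Val.measurable_proj _)
            ((Val.measurable_proj _).prodMk (measurable_pi_apply _)) ?_
            hX' (hproj R) (hproj P) (fun t x y => hXin t x y) (fun t x y => hTout R hvR x y)
            (fun t x y => hTout P hvP x y)
          intro p
          refine Prod.ext (funext fun ⟨w, hw⟩ => ?_) (Val.extend_self hS₂ _ _ _)
          refine Val.extend_of_ne hS₂ p.1 p.2 _ ?_
          rintro rfl
          exact hw.2.elim hvJ h.2.1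
        · exact ih.step_left ((M.kernel ⟨v, h.1⟩).comap (Val.merge hPa')
            (Val.measurable_merge _)) (c := Val.cons v l)
            hint' (φ := Val.proj (hS₃ hvS)) (ψ := fun _ => Val.proj (hT₃ R hvR))
            (χ := Val.extend v (hT₂ P)) (π := Val.proj hS₁)
            (Val.measurable_proj _) (fun _ => Val.measurable_proj _) (Val.measurable_extend _ _)
            (Val.measurable_proj _) (fun _ => rfl)
            hX' (hproj R) (hproj P) (fun t x y => hXout hvS t x y) (fun t x y => hTout R hvR x y)
            (fun t x y => hTin P x y)
      · -- the new variable depends on the variables in `R` and `S`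
        -- Inputs in `R` are not part of `Y`; they enter as the parameter `t`, on which the kernel
        -- in `step_right` may depend.
        have hPa' : M.G.Pa v ⊆ S ∩ (M.G.J ∪ {w | w ∈ l}) ∪ (M.G.J ∪ R ∩ {w | w ∈ l}) := by
          intro w hw
          rcases hPa hw with hR | hS
          · exact Or.inr ((h.2.2.1 hw).imp id fun h => ⟨hR, h⟩)
          · exact Or.inl ⟨hS, h.2.2.1 hw⟩
        have hm : ∀ (t : Val 𝒳 M.G.J) (x : Val 𝒳 {w | w ∈ l}),
            Val.merge h.2.2.1 (t, x) = Val.merge hPa' (Val.merge Set.inter_subset_right (t, x),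
              Val.merge subset_rfl (t, Val.proj Set.inter_subset_right x)) := by
          intro t x
          funext ⟨w, hw⟩
          by_cases hS : w ∈ S ∩ (M.G.J ∪ {w | w ∈ l})
          · rw [Val.merge_of_mem hPa' _ _ _ hS]
            rfl
          · rw [Val.merge_of_notMem hPa' _ _ _ hS]
            by_cases hJ : w ∈ M.G.J
            · rw [Val.merge_of_mem _ _ _ _ hJ, Val.merge_of_mem _ _ _ _ hJ]
            · rw [Val.merge_of_notMem _ _ _ _ hJ, Val.merge_of_notMem _ _ _ _ hJ]
              rfl
        have hmeas : ∀ t : Val 𝒳 M.G.J, Measurable fun p :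
            Val 𝒳 (S ∩ (M.G.J ∪ {w | w ∈ l})) × Val 𝒳 (R ∩ {w | w ∈ l}) =>
            Val.merge hPa' (p.1, Val.merge subset_rfl (t, p.2)) := fun t =>
          (Val.measurable_merge _).comp (measurable_fst.prodMk
            ((Val.measurable_merge _).comp (measurable_const.prodMk measurable_snd)))
        have hint' := hint
        simp only [hm] at hint'
        have hπ : ∀ (x : Val 𝒳 (S ∩ (M.G.J ∪ {w | w ∈ l}))) (y : 𝒳 v),
            Val.proj hS₁ (Val.extend v hS₂ (x, y)) = x := by
          intro x y
          funext ⟨w, hw⟩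
          refine Val.extend_of_ne hS₂ _ _ _ ?_
          rintro rfl
          exact hw.2.elim hvJ h.2.1
        -- One call covers `v ∈ R` and `v ∈ S`: `Val.extend` drops the new coordinate when the
        -- target index set does not contain `v`.
        exact ih.step_right (fun t => (M.kernel ⟨v, h.1⟩).comap _ (hmeas t))
          (fun t => inferInstance) (c := Val.cons v l)
          hint' (φ := Val.extend v hS₂) (ψ := fun _ => Val.extend v (hT₂ R))
          (χ := Val.proj (hT₃ P hvP)) (π := Val.proj hS₁)
          (Val.measurable_extend _ _) (fun _ => Val.measurable_extend _ _)
          (Val.measurable_proj _) (Val.measurable_proj _) hπ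
          hX' (hproj R) (hproj P) (fun t x y => hXin t x y) (fun t x y => hTin R x y)
          (fun t x y => hTout P hvP x y)
    · simp only [Set.mem_union, not_or] at hvZ
      obtain ⟨⟨hvP, hvR⟩, hvS⟩ := hvZ
      exact ih.step_skip (fun _ _ => inferInstance) (c := Val.cons v l) hint
        (φ := Val.proj (hS₃ hvS)) (ψ := fun _ => Val.proj (hT₃ R hvR))
        (χ := Val.proj (hT₃ P hvP)) (π := Val.proj hS₁)
        (Val.measurable_proj _) (fun _ => Val.measurable_proj _) (Val.measurable_proj _)
        (Val.measurable_proj _) (fun _ => rfl)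
        hX' (hproj R) (hproj P) (fun t x y => hXout hvS t x y) (fun t x y => hTout R hvR x y)
        (fun t x y => hTout P hvP x y)

end CausalBN

/-! ### Observed variables: the global Markov property, versions and their uniqueness. -/

/-- A countable generating algebra is a π-system, so equality of two probability measures is a
countable family of equalities of measurable functions. -/
theorem ProbabilityTheory.Kernel.measurableSet_setOf_eq {α γ : Type*} [MeasurableSpace α]
    [MeasurableSpace γ] [MeasurableSpace.CountablyGenerated γ] (κ η : Kernel α γ)
    [IsMarkovKernel κ] [IsMarkovKernel η] : MeasurableSet {a | κ a = η a} := by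
  set C := generateSetAlgebra (MeasurableSpace.countableGeneratingSet γ)
  have hgen : MeasurableSpace.generateFrom C = ‹MeasurableSpace γ› := by
    rw [generateFrom_generateSetAlgebra_eq, MeasurableSpace.generateFrom_countableGeneratingSet]
  have hC : C.Countable :=
    countable_generateSetAlgebra MeasurableSpace.countable_countableGeneratingSet
  have h : {a | κ a = η a} = ⋂ s ∈ C, {a | κ a s = η a s} := by
    ext a
    simp only [Set.mem_ofPred_eq, Set.mem_iInter]
    refine ⟨fun h s _ => by rw [h], fun h => ?_⟩
    refine ext_of_generate_finite C hgen.symm (fun s hs t ht _ => ?_) h (by simp)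
    exact isSetAlgebra_generateSetAlgebra.inter_mem hs ht
  rw [h]
  refine MeasurableSet.biInter hC fun s hs => ?_
  have hsm : MeasurableSet s := hgen ▸ MeasurableSpace.measurableSet_generateFrom hs
  exact measurableSet_eq_fun (κ.measurable_coe hsm) (η.measurable_coe hsm)

namespace CausalBN

open scoped ENNReal

variable {N : Type*} {𝒳 : N → Type*} [∀ v, MeasurableSpace (𝒳 v)]

theorem standardBorelSpace_val [Finite N] (M : CausalBN 𝒳) {A : Set N} (hA : A ⊆ M.V) :
    StandardBorelSpace (Val 𝒳 A) := by
  have : ∀ a : A, StandardBorelSpace (𝒳 a) := fun a => M.standard a (hA a.2).1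
  infer_instance

theorem lintegral_joint (M : CausalBN 𝒳) (o : M.G.TopOrder) (t : Val 𝒳 M.G.J)
    {g : Val 𝒳 M.G.V → ℝ≥0∞} (hg : Measurable g) :
    ∫⁻ x, g x ∂M.joint o t =
      ∫⁻ x, g (Val.proj o.complete x) ∂M.productKernel o.list o.ordered t :=
  Kernel.lintegral_map _ (Val.measurable_proj _) _ hg

theorem subset_J_union {M : CausalBN 𝒳} {S : Set N} (hS : S ⊆ M.G.J ∪ M.V) :
    S ⊆ M.G.J ∪ M.G.V :=
  hS.trans (Set.union_subset_union_right _ Set.sdiff_subset)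

/-- The global Markov property. -/
theorem transCI_joint [Finite N] (M : CausalBN 𝒳) (o : M.G.TopOrder) {A B S : Set N}
    (hA : A ⊆ M.V) (hB : B ⊆ M.V) (hS : S ⊆ M.G.J ∪ M.V) (hAS : Disjoint A S)
    (hBS : Disjoint B S) (hsep : M.marginalGraph.SigmaSep A B S) :
    TransCI (fun t => M.joint o t)
      (fun t x => (Val.merge (subset_J_union hS) (t, x) : Val 𝒳 S))
      (fun _ x => (Val.proj (hB.trans Set.sdiff_subset) x : Val 𝒳 B))
      (fun _ x => (Val.proj (hA.trans Set.sdiff_subset) x : Val 𝒳 A)) := by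
  have hSU : Disjoint S M.U := by
    rw [Set.disjoint_left]
    intro v hv hvU
    rcases hS hv with h | h
    exacts [Set.disjoint_left.1 M.G.disj h (M.U_subset hvU), h.2 hvU]
  obtain ⟨P, R, hPR, hAP, hBR, hPJ⟩ := hsep.exists_isSeparation M.U_subset hB hA hSU hAS hBS
  have hS' : S ⊆ S ∩ (M.G.J ∪ {w | w ∈ o.list}) := fun v hv =>
    ⟨hv, (hS hv).imp id fun h => o.complete h.1⟩
  have hA' : A ⊆ P ∩ {w | w ∈ o.list} := fun v hv => ⟨hAP hv, o.complete (hA hv).1⟩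
  have hB' : B ⊆ R ∩ {w | w ∈ o.list} := fun v hv => ⟨hBR hv, o.complete (hB hv).1⟩
  -- A step with a dummy variable only restricts the variables from `P` to `A` and from `R` to `B`,
  -- and passes from the product kernel to the joint kernel.
  refine (M.transCI_productKernel hPR hPJ o.list o.ordered).step_skip (δ := Unit)
    (κ := fun _ _ => Measure.dirac ()) (fun _ _ => inferInstance)
    (c := fun p => Val.proj o.complete p.1) (fun t g hg => ?_) (φ := Val.proj hS')
    (ψ := fun _ => Val.proj hB') (χ := Val.proj hA') (π := Val.proj Set.inter_subset_left)
    (Val.measurable_proj _) (fun _ => Val.measurable_proj _) (Val.measurable_proj _)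
    (Val.measurable_proj _) (fun _ => rfl)
    (fun t => (Val.measurable_merge _).comp measurable_prodMk_left)
    (fun _ => Val.measurable_proj _) (fun _ => Val.measurable_proj _)
    (fun t x _ => ?_) (fun _ _ _ => rfl) (fun _ _ _ => rfl)
  · simp [M.lintegral_joint o t hg]
  · funext ⟨w, hw⟩
    by_cases hJ : w ∈ M.G.J
    · rw [Val.merge_of_mem _ _ _ _ hJ]
      exact (Val.merge_of_mem Set.inter_subset_right t x (hS' hw) hJ).symm
    · rw [Val.merge_of_notMem _ _ _ _ hJ]
      exact (Val.merge_of_notMem Set.inter_subset_right t x (hS' hw) hJ).symm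

/-- Testing the disintegration identity against measurable functions brings it to the form supplied
by `TransCI`. -/
theorem isVersion_of_lintegral (M : CausalBN 𝒳) (o : M.G.TopOrder) {A S R : Set N}
    (Q : Kernel (Val 𝒳 R) (Val 𝒳 A)) [IsMarkovKernel Q] (hS : S ⊆ M.V) (hA : A ⊆ M.V)
    (hR : R ⊆ M.G.J ∪ S)
    (h : ∀ t, ∀ f : Val 𝒳 S × Val 𝒳 A → ℝ≥0∞, Measurable f →
      ∫⁻ x, f (Val.proj (hS.trans Set.sdiff_subset) x, Val.proj (hA.trans Set.sdiff_subset) x)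
          ∂M.joint o t =
        ∫⁻ x, ∫⁻ a, f (Val.proj (hS.trans Set.sdiff_subset) x, a)
          ∂Q (Val.merge hR (t, Val.proj (hS.trans Set.sdiff_subset) x)) ∂M.joint o t) :
    M.IsVersion o A S Q := by
  refine ⟨hS, hA, hR, ⟨Kernel.ext_fun fun t f hf => ?_⟩⟩
  have hpS := Val.measurable_proj (𝒳 := 𝒳) (hS.trans Set.sdiff_subset)
  have hpA := Val.measurable_proj (𝒳 := 𝒳) (hA.trans Set.sdiff_subset)
  have hm : Measurable fun s : Val 𝒳 S => ∫⁻ a, f (s, a) ∂Q (Val.merge hR (t, s)) :=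
    measurable_lintegral_kernel hf ((Val.measurable_merge hR).comp measurable_prodMk_left)
  rw [Kernel.lintegral_compProd _ _ _ hf, marginalPair, Kernel.fst_map_prod _ hpA,
    Kernel.lintegral_map _ (hpS.prodMk hpA) _ hf, h t f hf]
  exact Kernel.lintegral_map _ hpS _ hm

/-- Two versions of a conditional Markov kernel agree almost surely. -/
theorem IsVersion.ae_eq [Finite N] {M : CausalBN 𝒳} {o : M.G.TopOrder} {A S R : Set N}
    {Q Q' : Kernel (Val 𝒳 R) (Val 𝒳 A)} [IsMarkovKernel Q] [IsMarkovKernel Q']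
    (h : M.IsVersion o A S Q) (h' : M.IsVersion o A S Q') (hS : S ⊆ M.V)
    (hR : R ⊆ M.G.J ∪ S) (t : Val 𝒳 M.G.J) :
    ∀ᵐ s ∂M.marginal o S hS t, Q (Val.merge hR (t, s)) = Q' (Val.merge hR (t, s)) := by
  obtain ⟨_, hA, _, h⟩ := h
  obtain ⟨_, _, _, h'⟩ := h'
  have := M.standardBorelSpace_val hA
  have hfst : (M.marginalPair o S A hS hA).fst = M.marginal o S hS := by
    rw [marginalPair, Kernel.fst_map_prod _ (Val.measurable_proj _)]
    rfl
  have heq := (Kernel.disintegrate (M.marginalPair o S A hS hA)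
    (Q.comap (Val.merge hR) (Val.measurable_merge hR))).trans
    (Kernel.disintegrate (M.marginalPair o S A hS hA)
      (Q'.comap (Val.merge hR) (Val.measurable_merge hR))).symm
  have heq' := DFunLike.congr_fun heq t
  rw [Kernel.compProd_apply_eq_compProd_sectR, Kernel.compProd_apply_eq_compProd_sectR,
    hfst] at heq'
  have hm : IsMarkovKernel (M.marginal o S hS) := by
    rw [← hfst]
    infer_instance
  exact Kernel.ae_eq_of_compProd_eq heq'

end CausalBN

/-! ### Soft interventions at fixed input values are hard interventions. -/

namespace CausalBN

open scoped ENNReal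

variable {N : Type*} {𝒳 : N → Type*} [∀ v, MeasurableSpace (𝒳 v)]

theorem soft_kernel_of_inl (M : CausalBN 𝒳) {W : Set N} {v : N} (hW : v ∈ W) (hv : v ∈ M.G.V)
    (p : Val (SoftSpace 𝒳) ((M.G.soft W).Pa (Sum.inl v))) {y : 𝒳 v}
    (hp : p ⟨Sum.inr v, ⟨rfl, hW, hv⟩⟩ = (Sum.inl y : 𝒳 v ⊕ Unit)) :
    (M.soft W).kernel ⟨Sum.inl v, ⟨v, hv, rfl⟩⟩ p = (Measure.dirac y : Measure (𝒳 v)) := by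
  change M.softNodeKernel W v hv p = _
  rw [softNodeKernel, dif_pos hW]
  change Sum.elim Measure.dirac _ (p ⟨Sum.inr v, ⟨rfl, hW, hv⟩⟩ : 𝒳 v ⊕ Unit) = _
  rw [hp]
  rfl

theorem soft_kernel_of_forall (M : CausalBN 𝒳) {W : Set N} {v : N} (hv : v ∈ M.G.V)
    (p : Val (SoftSpace 𝒳) ((M.G.soft W).Pa (Sum.inl v)))
    (hp : ∀ hW : v ∈ W, p ⟨Sum.inr v, ⟨rfl, hW, hv⟩⟩ = (Sum.inr () : 𝒳 v ⊕ Unit)) :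
    (M.soft W).kernel ⟨Sum.inl v, ⟨v, hv, rfl⟩⟩ p =
      (M.kernel ⟨v, hv⟩ (Val.unlift CDMG.inl_mem_Pa_soft p) : Measure (𝒳 v)) := by
  change M.softNodeKernel W v hv p = _
  rw [softNodeKernel]
  by_cases hW : v ∈ W
  · rw [dif_pos hW]
    change Sum.elim Measure.dirac _ (p ⟨Sum.inr v, ⟨rfl, hW, hv⟩⟩ : 𝒳 v ⊕ Unit) = _
    rw [hp hW]
    rfl
  · rw [dif_neg hW]
    rfl

/-- The input values of the network after the hard intervention on `D` and the soft intervention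
on `B` describe the same intervention as the input values after the hard intervention on
`D ∪ B₂`. -/
structure SameInput (M : CausalBN 𝒳) (D B B₂ : Set N)
    (t₁ : Val (SoftSpace 𝒳) ((M.hard D).soft B).G.J)
    (t₂ : Val 𝒳 (M.hard (D ∪ B₂)).G.J) : Prop where
  input : ∀ v h₁ h₂, t₁ ⟨Sum.inl v, h₁⟩ = t₂ ⟨v, h₂⟩
  value : ∀ v ∈ B₂, ∀ h₁ h₂, t₁ ⟨Sum.inr v, h₁⟩ = (Sum.inl (t₂ ⟨v, h₂⟩) : 𝒳 v ⊕ Unit)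
  star : ∀ v ∉ B₂, ∀ h₁, t₁ ⟨Sum.inr v, h₁⟩ = (Sum.inr () : 𝒳 v ⊕ Unit)

variable {M : CausalBN 𝒳} {D B B₂ : Set N}

theorem inl_mem_soft_J {v : N} :
    Sum.inl v ∈ ((M.hard D).soft B).G.J ↔ v ∈ M.G.J ∪ D := by
  refine ⟨?_, fun h => Or.inl ⟨v, h, rfl⟩⟩
  rintro (⟨w, hw, h⟩ | ⟨w, hw, h⟩) <;> cases h
  exact hw

theorem inr_mem_soft_J {v : N} : Sum.inr v ∈ ((M.hard D).soft B).G.J ↔ v ∈ B := by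
  refine ⟨?_, fun h => Or.inr ⟨v, h, rfl⟩⟩
  rintro (⟨w, hw, h⟩ | ⟨w, hw, h⟩) <;> cases h
  exact hw

open scoped Classical in
/-- The products along a topological order in the network with soft interventions and in the
network with the corresponding hard interventions. -/
theorem lintegral_productKernel_soft {t₁ : Val (SoftSpace 𝒳) ((M.hard D).soft B).G.J}
    {t₂ : Val 𝒳 (M.hard (D ∪ B₂)).G.J} (ht : M.SameInput D B B₂ t₁ t₂) (hB₂ : B₂ ⊆ B) :
    ∀ (l : List N) (_ : M.G.IsOrdered l) (l₁ : List (N ⊕ N)) (l₂ : List N)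
      (h₁ : ((M.hard D).soft B).G.IsOrdered l₁) (h₂ : (M.hard (D ∪ B₂)).G.IsOrdered l₂)
      (_ : l₁ = (l.filter (· ∉ D)).map Sum.inl) (_ : l₂ = l.filter (· ∉ D ∪ B₂))
      (T : Set N) (_ : T = {w | w ∈ l ∧ w ∉ D}) (hT₁ : ∀ w ∈ T, Sum.inl w ∈ {w | w ∈ l₁})
      (hT₂ : T ⊆ {w | w ∈ l₂} ∪ (M.hard (D ∪ B₂)).G.J)
      (g : Val 𝒳 T → ℝ≥0∞) (_ : Measurable g),
      ∫⁻ x, g (Val.unlift hT₁ x) ∂((M.hard D).soft B).productKernel l₁ h₁ t₁ =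
        ∫⁻ x, g (Val.merge hT₂ (x, t₂)) ∂(M.hard (D ∪ B₂)).productKernel l₂ h₂ t₂
  | [], _, l₁, l₂, h₁, h₂, e₁, e₂, T, hT, hT₁, hT₂, g, hg => by
    have : Subsingleton (Val 𝒳 T) := ⟨fun _ _ => funext fun v => by
      have := v.2
      simp [hT] at this⟩
    have := ((M.hard D).soft B).productKernel_markov l₁ h₁
    have := (M.hard (D ∪ B₂)).productKernel_markov l₂ h₂
    let z : Val 𝒳 T := fun v => by
      have := v.2
      simp [hT] at this
    rw [lintegral_congr fun x => congrArg g (Subsingleton.elim (Val.unlift hT₁ x) z),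
      lintegral_congr fun x => congrArg g (Subsingleton.elim (Val.merge hT₂ (x, t₂)) z)]
    simp
  | v :: l, h, l₁, l₂, h₁, h₂, e₁, e₂, T, hT, hT₁, hT₂, g, hg => by
    -- A node of `D` is an input in both networks and changes nothing. The lists and `T` are tied to
    -- `l` only by equations, so the recursive call takes them as they are.
    by_cases hvD : v ∈ D
    · have hTl : T = {w | w ∈ l ∧ w ∉ D} := by
        rw [hT]
        ext w
        simp only [List.mem_cons, Set.mem_ofPred_eq]
        refine ⟨fun hw => ⟨hw.1.resolve_left ?_, hw.2⟩, fun hw => ⟨Or.inr hw.1, hw.2⟩⟩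
        rintro rfl
        exact hw.2 hvD
      exact lintegral_productKernel_soft ht hB₂ l h.2.2.2 l₁ l₂ h₁ h₂
        (by rw [e₁, List.filter_cons_of_neg (by simpa using hvD)])
        (by rw [e₂, List.filter_cons_of_neg (by simp [hvD])])
        T hTl hT₁ hT₂ g hg
    rw [List.filter_cons_of_pos (by simpa using hvD), List.map_cons] at e₁
    subst e₁
    set l₁' := (l.filter (· ∉ D)).map Sum.inl
    set T' : Set N := {w | w ∈ l ∧ w ∉ D}
    have hvV : v ∈ M.G.V := h.1
    have hTT' : T ⊆ insert v T' := by
      rw [hT]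
      exact fun w hw => (List.mem_cons.1 hw.1).imp id fun h => ⟨h, hw.2⟩
    have hT₁' : ∀ w ∈ T', Sum.inl w ∈ {w | w ∈ l₁'} := fun w hw =>
      List.mem_map_of_mem (List.mem_filter.2 ⟨hw.1, by simpa using hw.2⟩)
    have hT'V : ∀ w ∈ T', w ∈ M.G.V := fun w hw => h.2.2.2.mem_V w hw.1
    have hul : ∀ (x : Val (SoftSpace 𝒳) {w | w ∈ l₁'}) (y : 𝒳 v),
        Val.unlift hT₁ (Val.cons (Sum.inl v) l₁' (x, y)) =
          Val.extend v hTT' (Val.unlift hT₁' x, y) := by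
      intro x y
      funext ⟨w, hw⟩
      by_cases hwv : w = v
      · subst hwv
        rw [Val.extend_self]
        exact Val.cons_self _ _ _
      · rw [Val.extend_of_ne _ _ _ _ hwv]
        exact Val.cons_of_ne _ _ _ fun h => hwv (Sum.inl.inj h)
    have hJ₂ : ∀ w, w ∈ M.G.J ∪ D → w ∈ (M.hard (D ∪ B₂)).G.J := fun w hw =>
      hw.imp id Or.inl
    have hgu : Measurable fun x : Val (SoftSpace 𝒳) {w | w ∈ Sum.inl v :: l₁'} =>
        g (Val.unlift hT₁ x) := hg.comp (Val.measurable_unlift _)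
    have hge := hg.comp (Val.measurable_extend v hTT')
    let κ : Val (SoftSpace 𝒳) {w | w ∈ l₁'} → Measure (𝒳 v) := fun x =>
      ((M.hard D).soft B).kernel ⟨Sum.inl v, h₁.1⟩ (Val.merge h₁.2.2.1 (t₁, x))
    have hstep : ∫⁻ x, g (Val.unlift hT₁ x)
          ∂((M.hard D).soft B).productKernel (Sum.inl v :: l₁') h₁ t₁ =
        ∫⁻ x, ∫⁻ y, g (Val.extend v hTT' (Val.unlift hT₁' x, y)) ∂κ x
          ∂((M.hard D).soft B).productKernel l₁' h₁.2.2.2 t₁ :=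
      (lintegral_productKernel_cons _ _ _ h₁ _ hgu).trans
        (lintegral_congr fun x => lintegral_congr fun y => congrArg g (hul x y))
    rw [hstep]
    by_cases hvB₂ : v ∈ B₂
    · -- the value of `X_v` is fixed
      rw [List.filter_cons_of_neg (by simp [hvB₂])] at e₂
      have hvJ₂ : v ∈ (M.hard (D ∪ B₂)).G.J := Or.inr (Or.inr hvB₂)
      have hT₂' : T' ⊆ {w | w ∈ l₂} ∪ (M.hard (D ∪ B₂)).G.J := fun w hw =>
        hT₂ (by rw [hT]; exact ⟨List.mem_cons_of_mem _ hw.1, hw.2⟩)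
      have hκ : ∀ x, κ x = Measure.dirac (t₂ ⟨v, hvJ₂⟩) := by
        intro x
        refine (M.hard D).soft_kernel_of_inl (hB₂ hvB₂) ⟨hvV, hvD⟩ _ ?_
        exact (Val.merge_of_mem (v := Sum.inr v) h₁.2.2.1 t₁ x ⟨rfl, hB₂ hvB₂, hvV, hvD⟩
          (inr_mem_soft_J.2 (hB₂ hvB₂))).trans (ht.value v hvB₂ _ _)
      have hk : ∀ x, ∫⁻ y, g (Val.extend v hTT' (Val.unlift hT₁' x, y)) ∂κ x =
          g (Val.extend v hTT' (Val.unlift hT₁' x, t₂ ⟨v, hvJ₂⟩)) := by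
        intro x
        rw [hκ]
        exact lintegral_dirac' _ (hge.comp measurable_prodMk_left)
      rw [lintegral_congr hk]
      rw [lintegral_productKernel_soft ht hB₂ l h.2.2.2 l₁' l₂ h₁.2.2.2 h₂ rfl e₂ T' rfl hT₁' hT₂'
        (fun z => g (Val.extend v hTT' (z, t₂ ⟨v, hvJ₂⟩)))
        (hge.comp (measurable_id.prodMk measurable_const))]
      refine lintegral_congr fun x => congrArg g ?_
      funext ⟨w, hw⟩
      by_cases hwv : w = v
      · subst hwv
        rw [Val.extend_self, Val.merge_of_notMem]
        rw [e₂]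
        simp [hvB₂]
      · rw [Val.extend_of_ne _ _ _ _ hwv]
        rfl
    · -- `X_v` is sampled in both networks
      rw [List.filter_cons_of_pos (by simp [hvD, hvB₂])] at e₂
      subst e₂
      set l₂' := l.filter (· ∉ D ∪ B₂)
      have hT₂' : T' ⊆ {w | w ∈ l₂'} ∪ (M.hard (D ∪ B₂)).G.J := by
        intro w hw
        by_cases hwB : w ∈ B₂
        · exact Or.inr (Or.inr (Or.inr hwB))
        · exact Or.inl (List.mem_filter.2 ⟨hw.1, by simp [hw.2, hwB]⟩)
      have hPa : M.G.Pa v ⊆ T' ∪ (M.hard (D ∪ B₂)).G.J := by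
        intro w hw
        rcases h.2.2.1 hw with hJ | hl
        · exact Or.inr (Or.inl hJ)
        · by_cases hwD : w ∈ D
          · exact Or.inr (hJ₂ w (Or.inr hwD))
          · exact Or.inl ⟨hl, hwD⟩
      have hmk := M.markov ⟨v, hvV⟩
      -- With `hk₂`, both kernels at `v` become the same function of the values on `T'` and `t₂`, so
      -- the inner integral is a test function for the recursive call.
      have hk₁ : ∀ x, κ x = M.kernel ⟨v, hvV⟩ (Val.merge hPa (Val.unlift hT₁' x, t₂)) := by
        intro x
        refine ((M.hard D).soft_kernel_of_forall ⟨hvV, hvD⟩ _ ?_).trans ?_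
        rotate_left
        · refine congrArg (M.kernel ⟨v, hvV⟩) (funext fun ⟨w, hw⟩ => ?_)
          have hw' : M.G.E w v := hw
          by_cases hJ : w ∈ M.G.J ∪ D
          · have hwT : w ∉ T' := fun hwT =>
              hJ.elim (fun h => Set.disjoint_left.1 M.G.disj h (hT'V w hwT)) hwT.2
            rw [Val.merge_of_notMem _ _ _ _ hwT]
            exact (Val.merge_of_mem (v := Sum.inl w) h₁.2.2.1 t₁ x ⟨hw', hvD⟩ (inl_mem_soft_J.2 hJ)).trans
              (ht.input _ _ _)
          · have hwT : w ∈ T' :=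
              ⟨(h.2.2.1 hw).resolve_left fun h => hJ (Or.inl h), fun h => hJ (Or.inr h)⟩
            rw [Val.merge_of_mem _ _ _ _ hwT]
            exact Val.merge_of_notMem (v := Sum.inl w) h₁.2.2.1 t₁ x ⟨hw', hvD⟩ (mt inl_mem_soft_J.1 hJ)
        · intro hvB
          exact (Val.merge_of_mem (v := Sum.inr v) h₁.2.2.1 t₁ x ⟨rfl, hvB, hvV, hvD⟩
            (inr_mem_soft_J.2 hvB)).trans (ht.star v hvB₂ _)
      have hk₂ : ∀ x, (M.hard (D ∪ B₂)).kernel ⟨v, h₂.1⟩ (Val.merge h₂.2.2.1 (t₂, x)) =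
          M.kernel ⟨v, hvV⟩ (Val.merge hPa (Val.merge hT₂' (x, t₂), t₂)) := by
        intro x
        refine congrArg (M.kernel ⟨v, hvV⟩) (funext fun ⟨w, hw⟩ => ?_)
        have hw' : w ∈ (M.hard (D ∪ B₂)).G.Pa v := ⟨hw, fun h => h.elim hvD hvB₂⟩
        by_cases hJ : w ∈ (M.hard (D ∪ B₂)).G.J
        · refine (Val.merge_of_mem h₂.2.2.1 t₂ x hw' hJ).trans ?_
          by_cases hwT : w ∈ T'
          · rw [Val.merge_of_mem _ _ _ _ hwT, Val.merge_of_notMem]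
            intro hwl
            have hwl' := (List.mem_filter.1 hwl).2
            rcases hJ with hJ | hJ
            · exact Set.disjoint_left.1 M.G.disj hJ (hT'V w hwT)
            · simp only [decide_eq_true_eq] at hwl'
              exact hwl' hJ
          · rw [Val.merge_of_notMem _ _ _ _ hwT]
        · refine (Val.merge_of_notMem h₂.2.2.1 t₂ x hw' hJ).trans ?_
          have hwT : w ∈ T' := (hPa hw).resolve_right hJ
          rw [Val.merge_of_mem _ _ _ _ hwT, Val.merge_of_mem]
      have hgm : Measurable fun x : Val 𝒳 {w | w ∈ v :: l₂'} => g (Val.merge hT₂ (x, t₂)) :=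
        hg.comp ((Val.measurable_merge _).comp measurable_prodMk_right)
      rw [lintegral_productKernel_cons _ _ _ h₂ _ hgm]
      have hme : ∀ x y, Val.merge hT₂ (Val.cons v l₂' (x, y), t₂) =
          Val.extend v hTT' (Val.merge hT₂' (x, t₂), y) := by
        intro x y
        funext ⟨w, hw⟩
        by_cases hwv : w = v
        · subst hwv
          rw [Val.extend_self,
            Val.merge_of_mem _ _ _ _ (show w ∈ {u | u ∈ w :: l₂'} from List.mem_cons_self),
            Val.cons_self]
        · rw [Val.extend_of_ne _ _ _ _ hwv]
          by_cases hwl : w ∈ l₂'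
          · have hwl' : w ∈ {u | u ∈ l₂'} := hwl
            rw [Val.merge_of_mem _ _ _ _ (show w ∈ {u | u ∈ v :: l₂'} from
              List.mem_cons_of_mem v hwl), Val.merge_of_mem _ _ _ _ hwl',
              Val.cons_of_ne _ _ _ hwv]
          · rw [Val.merge_of_notMem hT₂' _ _ _ hwl, Val.merge_of_notMem]
            exact fun h => (List.mem_cons.1 h).elim hwv hwl
      simp only [hme, hk₂]
      have hgk : Measurable fun z : Val 𝒳 T' => ∫⁻ y, g (Val.extend v hTT' (z, y))
          ∂M.kernel ⟨v, hvV⟩ (Val.merge hPa (z, t₂)) :=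
        measurable_lintegral_kernel (Q := M.kernel ⟨v, hvV⟩) hge
          ((Val.measurable_merge _).comp measurable_prodMk_right)
      refine Eq.trans (lintegral_congr fun x => ?_)
        (lintegral_productKernel_soft ht hB₂ l h.2.2.2 l₁' l₂' h₁.2.2.2 h₂.2.2.2 rfl rfl T' rfl
          hT₁' hT₂' _ hgk)
      rw [hk₁]

end CausalBN

namespace CausalBN

open scoped ENNReal

variable {N : Type*} {𝒳 : N → Type*} [∀ v, MeasurableSpace (𝒳 v)]

variable {M : CausalBN 𝒳} {D B B₂ : Set N}

theorem soft_V_eq : ((M.hard D).soft B).V = Sum.inl '' (M.hard D).V :=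
  (Set.image_sdiff Sum.inl_injective _ _).symm

theorem image_subset_soft_V {A : Set N} (hA : A ⊆ M.V) (hAD : Disjoint A D) :
    Sum.inl '' A ⊆ ((M.hard D).soft B).V := by
  rw [soft_V_eq]
  exact Set.image_mono fun _ hv =>
    ⟨⟨(hA hv).1, Set.disjoint_left.1 hAD hv⟩, fun h => (hA hv).2 h.1⟩

theorem subset_hard_V {A : Set N} (hA : A ⊆ M.V) (hAD : Disjoint A D) : A ⊆ (M.hard D).V :=
  fun v hv => ⟨⟨(hA hv).1, Set.disjoint_left.1 hAD hv⟩, fun h => (hA hv).2 h.1⟩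

/-- The joint distributions in the network with soft interventions and in the network with the
corresponding hard interventions agree. -/
theorem lintegral_joint_soft (o : M.G.TopOrder)
    {t₁ : Val (SoftSpace 𝒳) ((M.hard D).soft B).G.J}
    {t₂ : Val 𝒳 (M.hard (D ∪ B₂)).G.J} (ht : M.SameInput D B B₂ t₁ t₂) (hB₂ : B₂ ⊆ B)
    (h₁ : ∀ w ∈ (M.hard D).G.V, Sum.inl w ∈ ((M.hard D).soft B).G.V)
    (h₂ : (M.hard D).G.V ⊆ (M.hard (D ∪ B₂)).G.V ∪ (M.hard (D ∪ B₂)).G.J)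
    {g : Val 𝒳 (M.hard D).G.V → ℝ≥0∞} (hg : Measurable g) :
    ∫⁻ x, g (Val.unlift h₁ x) ∂((M.hard D).soft B).joint ((o.hard D).soft B) t₁ =
      ∫⁻ x, g (Val.merge h₂ (x, t₂)) ∂(M.hard (D ∪ B₂)).joint (o.hard (D ∪ B₂)) t₂ := by
  classical
  refine (lintegral_joint ((M.hard D).soft B) ((o.hard D).soft B) t₁
    (hg.comp (Val.measurable_unlift h₁))).trans (Eq.trans ?_
    (lintegral_joint (M.hard (D ∪ B₂)) (o.hard (D ∪ B₂)) t₂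
      (hg.comp ((Val.measurable_merge h₂).comp measurable_prodMk_right))).symm)
  let T : Set N := {w | w ∈ o.list ∧ w ∉ D}
  have hVT : (M.hard D).G.V ⊆ T := fun w hw => ⟨o.complete hw.1, hw.2⟩
  have hTV : T ⊆ (M.hard D).G.V := fun w hw => ⟨o.ordered.mem_V w hw.1, hw.2⟩
  have hT₁ : ∀ w ∈ T, Sum.inl w ∈ {w | w ∈ ((o.hard D).soft B).list} := fun w hw =>
    ((o.hard D).soft B).complete (h₁ w (hTV hw))
  have hT₂ : T ⊆ {w | w ∈ (o.hard (D ∪ B₂)).list} ∪ (M.hard (D ∪ B₂)).G.J := fun w hw =>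
    (h₂ (hTV hw)).imp (fun h => (o.hard (D ∪ B₂)).complete h) id
  refine (lintegral_productKernel_soft ht hB₂ o.list o.ordered _ _ ((o.hard D).soft B).ordered
    (o.hard (D ∪ B₂)).ordered rfl
    (List.filter_congr fun _ _ => decide_eq_decide.2 Iff.rfl) T rfl hT₁ hT₂ (fun z => g (Val.proj hVT z))
    (hg.comp (Val.measurable_proj _))).trans ?_
  refine lintegral_congr fun x => congrArg g (funext fun ⟨w, hw⟩ => ?_)
  by_cases hwV : w ∈ (M.hard (D ∪ B₂)).G.V
  · refine Eq.trans ?_ (Val.merge_of_mem h₂ _ t₂ hw hwV).symm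
    exact Val.merge_of_mem hT₂ _ _ (hVT hw) ((o.hard (D ∪ B₂)).complete hwV)
  · refine Eq.trans ?_ (Val.merge_of_notMem h₂ _ t₂ hw hwV).symm
    exact Val.merge_of_notMem hT₂ _ _ (hVT hw) fun h =>
      hwV ((o.hard (D ∪ B₂)).ordered.mem_V w h)

/-- The joint distribution of the variables in `R` (some of which may be input variables) and
`A` in the network with soft interventions. -/
theorem lintegral_joint_soft_pair (o : M.G.TopOrder)
    {t₁ : Val (SoftSpace 𝒳) ((M.hard D).soft B).G.J}
    {t₂ : Val 𝒳 (M.hard (D ∪ B₂)).G.J} (ht : M.SameInput D B B₂ t₁ t₂) (hB₂ : B₂ ⊆ B)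
    {A K R : Set N} (hA : A ⊆ (M.hard (D ∪ B₂)).G.V) (hK : K ⊆ (M.hard (D ∪ B₂)).G.V)
    (hR : R ⊆ (M.hard (D ∪ B₂)).G.J ∪ K) (hB₂V : B₂ ⊆ M.G.V)
    (h₁ : ∀ w ∈ A, Sum.inl w ∈ ((M.hard D).soft B).G.V)
    (h₂ : Sum.inl '' R ⊆ ((M.hard D).soft B).G.J ∪ ((M.hard D).soft B).G.V)
    {f : Val 𝒳 R × Val 𝒳 A → ℝ≥0∞} (hf : Measurable f) :
    ∫⁻ x, f (Val.unlift (fun _ hv => Set.mem_image_of_mem _ hv) (Val.merge h₂ (t₁, x)),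
        Val.unlift h₁ x) ∂((M.hard D).soft B).joint ((o.hard D).soft B) t₁ =
      ∫⁻ x, f (Val.merge hR (t₂, Val.proj hK x), Val.proj hA x)
        ∂(M.hard (D ∪ B₂)).joint (o.hard (D ∪ B₂)) t₂ := by
  classical
  have hV₁ : ∀ w ∈ (M.hard D).G.V, Sum.inl w ∈ ((M.hard D).soft B).G.V := fun w hw => ⟨w, hw, rfl⟩
  have hV₂ : (M.hard D).G.V ⊆ (M.hard (D ∪ B₂)).G.V ∪ (M.hard (D ∪ B₂)).G.J := by
    intro w hw
    by_cases h : w ∈ B₂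
    · exact Or.inr (Or.inr (Or.inr h))
    · exact Or.inl ⟨hw.1, fun h' => h'.elim hw.2 h⟩
  have hA' : A ⊆ (M.hard D).G.V := fun v hv => ⟨(hA hv).1, fun h => (hA hv).2 (Or.inl h)⟩
  have hR' : R ⊆ (M.hard D).G.V ∪ (M.hard (D ∪ B₂)).G.J := by
    intro v hv
    rcases hR hv with h | h
    · exact Or.inr h
    · exact Or.inl ⟨(hK h).1, fun h' => (hK h).2 (Or.inl h')⟩
  have hg : Measurable fun z : Val 𝒳 (M.hard D).G.V =>
      f (Val.merge hR' (z, t₂), Val.proj hA' z) :=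
    hf.comp (((Val.measurable_merge _).comp measurable_prodMk_right).prodMk
      (Val.measurable_proj _))
  have key := lintegral_joint_soft o ht hB₂ hV₁ hV₂ hg
  refine Eq.trans (lintegral_congr fun x => ?_) (key.trans (lintegral_congr fun x => ?_))
  · refine congrArg f (Prod.ext (funext fun ⟨w, hw⟩ => ?_) rfl)
    by_cases hwV : w ∈ (M.hard D).G.V
    · refine Eq.trans ?_ (Val.merge_of_mem hR' _ t₂ hw hwV).symm
      refine Val.merge_of_notMem (v := Sum.inl w) h₂ t₁ x ⟨w, hw, rfl⟩ fun h => ?_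
      exact (inl_mem_soft_J.1 h).elim (fun h => Set.disjoint_left.1 M.G.disj h hwV.1) hwV.2
    · refine Eq.trans ?_ (Val.merge_of_notMem hR' _ t₂ hw hwV).symm
      have hJ : w ∈ M.G.J ∪ D := by
        rcases (hR' hw).resolve_left hwV with h | h | h
        · exact Or.inl h
        · exact Or.inr h
        · by_contra hD
          exact hwV ⟨hB₂V h, fun h => hD (Or.inr h)⟩
      exact (Val.merge_of_mem (v := Sum.inl w) h₂ t₁ x ⟨w, hw, rfl⟩
        (inl_mem_soft_J.2 hJ)).trans (ht.input w _ _)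
  · refine congrArg f (Prod.ext (funext fun ⟨w, hw⟩ => ?_) (funext fun ⟨w, hw⟩ => ?_))
    · by_cases hwJ : w ∈ (M.hard (D ∪ B₂)).G.J
      · refine Eq.trans ?_ (Val.merge_of_mem hR t₂ _ hw hwJ).symm
        by_cases hwV : w ∈ (M.hard D).G.V
        · refine (Val.merge_of_mem hR' _ t₂ hw hwV).trans ?_
          exact Val.merge_of_notMem hV₂ x t₂ hwV
            (Set.disjoint_left.1 (M.hard (D ∪ B₂)).G.disj hwJ)
        · exact Val.merge_of_notMem hR' _ t₂ hw hwV
      · refine Eq.trans ?_ (Val.merge_of_notMem hR t₂ _ hw hwJ).symm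
        have hwV := hK ((hR hw).resolve_left hwJ)
        exact (Val.merge_of_mem hR' _ t₂ hw
          ⟨hwV.1, fun h => hwV.2 (Or.inl h)⟩).trans (Val.merge_of_mem hV₂ x t₂ _ hwV)
    · exact Val.merge_of_mem hV₂ x t₂ (hA' hw) (hA hw)

open scoped Classical in
/-- Input values for the soft interventions that describe given hard interventions. -/
theorem exists_sameInput_soft (t₂ : Val 𝒳 (M.hard (D ∪ B₂)).G.J) :
    ∃ t₁ : Val (SoftSpace 𝒳) ((M.hard D).soft B).G.J, M.SameInput D B B₂ t₁ t₂ := by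
  refine ⟨fun w => match w with
    | ⟨.inl v, h⟩ => (t₂ ⟨v, (inl_mem_soft_J.1 h).imp id Or.inl⟩ : 𝒳 v)
    | ⟨.inr v, _⟩ => (if hv : v ∈ B₂ then Sum.inl (t₂ ⟨v, Or.inr (Or.inr hv)⟩) else Sum.inr () :
        𝒳 v ⊕ Unit), fun v _ _ => rfl, fun v hv _ _ => dif_pos hv, fun v hv _ => dif_neg hv⟩

/-- Input values for the hard interventions that are described by given values for the soft
interventions. -/
theorem exists_sameInput_hard (hB : B ⊆ M.G.V) (hBD : Disjoint B D)
    (t₁ : Val (SoftSpace 𝒳) ((M.hard D).soft B).G.J) :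
    ∃ B₂ ⊆ B, ∃ t₂ : Val 𝒳 (M.hard (D ∪ B₂)).G.J, M.SameInput D B B₂ t₁ t₂ := by
  -- The nodes on which `t₁` imposes a value, that is, where it differs from `⋆`.
  let B₂ : Set N := {v | ∃ h, ∃ y : 𝒳 v, t₁ ⟨Sum.inr v, h⟩ = (Sum.inl y : 𝒳 v ⊕ Unit)}
  have hB₂ : B₂ ⊆ B := fun v ⟨h, _⟩ => inr_mem_soft_J.1 h
  have hex : ∀ v : N, v ∈ (M.hard (D ∪ B₂)).G.J → ∃ y : 𝒳 v,
      (∀ h, t₁ ⟨Sum.inl v, h⟩ = y) ∧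
      (v ∈ B₂ → ∀ h, t₁ ⟨Sum.inr v, h⟩ = (Sum.inl y : 𝒳 v ⊕ Unit)) := by
    intro v hv
    by_cases hJ : v ∈ M.G.J ∪ D
    · refine ⟨t₁ ⟨Sum.inl v, inl_mem_soft_J.2 hJ⟩, fun _ => rfl, fun hv' => ?_⟩
      exact (hJ.elim (fun h => Set.disjoint_left.1 M.G.disj h (hB (hB₂ hv')))
        (Set.disjoint_left.1 hBD (hB₂ hv'))).elim
    · obtain ⟨h, y, hy⟩ : v ∈ B₂ := by
        rcases hv with h | h | h
        exacts [absurd (Or.inl h) hJ, absurd (Or.inr h) hJ, h]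
      exact ⟨y, fun h => absurd (inl_mem_soft_J.1 h) hJ, fun _ _ => hy⟩
  choose x hx using hex
  refine ⟨B₂, hB₂, fun v => x v v.2, fun v h₁ h₂ => (hx v h₂).1 h₁,
    fun v hv h₁ h₂ => (hx v h₂).2 hv h₁, ?_⟩
  intro v hv h₁
  rcases h : (t₁ ⟨Sum.inr v, h₁⟩ : 𝒳 v ⊕ Unit) with y | y
  · exact absurd ⟨h₁, y, h⟩ hv
  · rfl

/-- A conditional Markov kernel of the network with soft interventions, given variables that
determine which values are imposed, is a version of the conditional Markov kernels in the networks
with hard interventions. -/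
theorem exists_isVersion_of_soft [Finite N] (o : M.G.TopOrder) {A R : Set N}
    (hA : A ⊆ M.V) (hB : B ⊆ M.V) (hR : R ⊆ M.G.J ∪ M.V ∪ D)
    (hAB : Disjoint A B) (hAD : Disjoint A D) (hAR : Disjoint A R)
    (hsep : ((M.hard D).soft B).marginalGraph.SigmaSep
        (Sum.inl '' A) (Sum.inr '' B) (Sum.inl '' R)) :
    ∃ Q : Kernel (Val 𝒳 R) (Val 𝒳 A), IsMarkovKernel Q ∧ ∀ B₂ ⊆ B, ∀ K ⊆ R, K ⊆ M.V →
      Disjoint K (D ∪ B₂) → R ⊆ (M.hard (D ∪ B₂)).G.J ∪ K →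
      (M.hard (D ∪ B₂)).IsVersion (o.hard (D ∪ B₂)) A K Q := by
  have hA₁ := image_subset_soft_V (B := B) hA hAD
  have hR₁ : Sum.inl '' R ⊆ ((M.hard D).soft B).G.J ∪ ((M.hard D).soft B).V := by
    rintro _ ⟨v, hv, rfl⟩
    by_cases hD : v ∈ D
    · exact Or.inl (inl_mem_soft_J.2 (Or.inr hD))
    rcases hR hv with (h | h) | h
    · exact Or.inl (inl_mem_soft_J.2 (Or.inl h))
    · refine Or.inr (image_subset_soft_V (A := {v}) ?_ ?_ ⟨v, rfl, rfl⟩) <;> simpa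
    · exact absurd h hD
  -- The nodes `I_B` are inputs of the soft network, so separation from them is already part of
  -- separation from `∅`.
  have hsep' : ((M.hard D).soft B).marginalGraph.SigmaSep (Sum.inl '' A) ∅ (Sum.inl '' R) :=
    fun a ha b hb => hsep a ha b (hb.imp id fun h => absurd h (Set.notMem_empty b))
  have hAR₁ : Disjoint (Sum.inl '' A : Set (N ⊕ N)) (Sum.inl '' R) :=
    (Set.disjoint_image_iff Sum.inl_injective).2 hAR
  obtain ⟨Q₁, hQ₁, hint⟩ := ((M.hard D).soft B).transCI_joint ((o.hard D).soft B) hA₁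
    (Set.empty_subset _) hR₁ hAR₁ (Set.empty_disjoint _) hsep'
  have hinl : ∀ S : Set N, ∀ v ∈ S, (Sum.inl v : N ⊕ N) ∈ Sum.inl '' S :=
    fun S v hv => Set.mem_image_of_mem _ hv
  let e : Val 𝒳 R → Val (SoftSpace 𝒳) (Sum.inl '' R) := fun x w => match w with
    | ⟨.inl v, h⟩ => (x ⟨v, by obtain ⟨u, hu, h⟩ := h; cases h; exact hu⟩ : 𝒳 v)
    | ⟨.inr v, h⟩ => absurd h (by rintro ⟨u, -, h⟩; cases h)
  have he : Measurable e := by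
    refine measurable_pi_iff.2 ?_
    rintro ⟨_, ⟨v, hv, rfl⟩⟩
    exact measurable_pi_apply (⟨v, hv⟩ : R)
  have heu : ∀ z : Val (SoftSpace 𝒳) (Sum.inl '' R), e (Val.unlift (hinl R) z) = z := by
    intro z
    funext ⟨w, hw⟩
    obtain ⟨v, hv, rfl⟩ := hw
    rfl
  have hu := Val.measurable_unlift (𝒳 := 𝒳) (hinl A)
  have hQ : IsMarkovKernel ((Q₁.comap e he).map (Val.unlift (hinl A))) :=
    Kernel.IsMarkovKernel.map _ hu
  refine ⟨(Q₁.comap e he).map (Val.unlift (hinl A)), hQ, fun B₂ hB₂ K hKR hK hKD hR₂ => ?_⟩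
  have hK₂ := subset_hard_V hK hKD
  have hA₂ : A ⊆ (M.hard (D ∪ B₂)).V :=
    subset_hard_V hA (Set.disjoint_union_right.2 ⟨hAD, hAB.mono_right hB₂⟩)
  refine isVersion_of_lintegral _ _ _ hK₂ hA₂ hR₂ fun t₂ f hf => ?_
  obtain ⟨t₁, ht⟩ := exists_sameInput_soft (B := B) t₂
  -- The test function reads only the coordinates in `K`; the other coordinates of `R` are inputs
  -- after the hard intervention and are fixed by `t₂`.
  have hf₁ : Measurable fun p : Val 𝒳 R × Val 𝒳 A => f (Val.proj hKR p.1, p.2) :=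
    hf.comp (((Val.measurable_proj _).comp measurable_fst).prodMk measurable_snd)
  have hf₂ : Measurable fun z : Val 𝒳 R =>
      ∫⁻ a, f (Val.proj hKR z, a) ∂(Q₁.comap e he).map (Val.unlift (hinl A)) z :=
    measurable_lintegral_kernel hf₁ measurable_id
  have hA₃ : ∀ w ∈ A, Sum.inl w ∈ ((M.hard D).soft B).G.V := fun w hw => (hA₁ ⟨w, hw, rfl⟩).1
  have hK₃ : ∀ x, Val.proj hKR (Val.merge hR₂
      (t₂, Val.proj (hK₂.trans Set.sdiff_subset) x)) =
      Val.proj (hK₂.trans Set.sdiff_subset) x := fun x => funext fun ⟨w, hw⟩ =>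
    Val.merge_of_notMem hR₂ t₂ _ (hKR hw) fun h =>
      Set.disjoint_left.1 (M.hard (D ∪ B₂)).G.disj h (hK₂ hw).1
  have hB₂V : B₂ ⊆ M.G.V := hB₂.trans (hB.trans Set.sdiff_subset)
  have e₁ := lintegral_joint_soft_pair o ht hB₂ (hA₂.trans Set.sdiff_subset)
    (hK₂.trans Set.sdiff_subset) hR₂ hB₂V hA₃ (subset_J_union hR₁) hf₁
  have e₂ := lintegral_joint_soft_pair o ht hB₂ (hA₂.trans Set.sdiff_subset)
    (hK₂.trans Set.sdiff_subset) hR₂ hB₂V hA₃ (subset_J_union hR₁) (hf₂.comp measurable_fst)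
  simp only [hK₃, Function.comp_apply] at e₁ e₂
  -- Both sides of the desired identity are moved to the soft network at `t₁`, where they are an
  -- instance of `hint`.
  refine e₁.symm.trans (Eq.trans ?_ e₂)
  refine (hint t₁ (fun p => f (Val.proj hKR (Val.unlift (hinl R) p.1), Val.unlift (hinl A) p.2.2))
    (hf₁.comp (((Val.measurable_unlift (hinl R)).comp measurable_fst).prodMk
      (hu.comp (measurable_snd.comp measurable_snd))))).trans ?_
  refine lintegral_congr fun x => ?_
  rw [Kernel.map_apply _ hu, Kernel.comap_apply, heu]
  exact (lintegral_map (f := fun a => f (Val.proj hKR (Val.unlift (hinl R)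
    (Val.merge (subset_J_union hR₁) (t₁, x))), a)) (hf.comp measurable_prodMk_left) hu).symm

/-- Versions of the conditional Markov kernels in the networks with hard interventions agree up
to a null set in the network with soft interventions. -/
theorem agreeUpToNull_soft [Finite N] (o : M.G.TopOrder) {A R K : Set N}
    (hB : B ⊆ M.V) (hBD : Disjoint B D) (hK : K ⊆ M.V) (hKD : Disjoint K D)
    (hR : R ⊆ M.G.J ∪ D ∪ K) (Q Q' : Kernel (Val 𝒳 R) (Val 𝒳 A)) [IsMarkovKernel Q]
    [IsMarkovKernel Q']
    (h : ∀ B₂ ⊆ B, (M.hard (D ∪ B₂)).IsVersion (o.hard (D ∪ B₂)) A (K \ B₂) Q)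
    (h' : ∀ B₂ ⊆ B, (M.hard (D ∪ B₂)).IsVersion (o.hard (D ∪ B₂)) A (K \ B₂) Q') :
    ((M.hard D).soft B).AgreeUpToNull ((o.hard D).soft B) (Sum.inl '' K) Q.lift Q'.lift := by
  have hK₁ := image_subset_soft_V (B := B) hK hKD
  have hR₁ : Sum.inl '' R ⊆ ((M.hard D).soft B).G.J ∪ Sum.inl '' K := by
    rintro _ ⟨v, hv, rfl⟩
    exact (hR hv).imp (fun h => inl_mem_soft_J.2 h) fun h => ⟨v, h, rfl⟩
  refine ⟨hK₁, hR₁, fun t₁ => ?_⟩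
  have hinl : ∀ v ∈ R, (Sum.inl v : N ⊕ N) ∈ Sum.inl '' R :=
    fun v hv => Set.mem_image_of_mem _ hv
  obtain ⟨B₂, hB₂, t₂, ht⟩ := exists_sameInput_hard (hB.trans Set.sdiff_subset) hBD t₁
  have hv := h B₂ hB₂
  obtain ⟨hK₂, hA₂, hR₂, -⟩ := id hv
  have hae := hv.ae_eq (h' B₂ hB₂) hK₂ hR₂ t₂
  have hst := (M.hard (D ∪ B₂)).standardBorelSpace_val hA₂
  -- Measurability lets the probability of disagreement be written as the integral of an indicator,
  -- which is comparable between the two networks.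
  have hE : MeasurableSet {z : Val 𝒳 R | Q z = Q' z}ᶜ := (Q.measurableSet_setOf_eq Q').compl
  set E : Set (Val 𝒳 R) := {z : Val 𝒳 R | Q z = Q' z}ᶜ
  have hm₁ : Measurable fun w : Val (SoftSpace 𝒳) (Sum.inl '' K) =>
      Val.unlift hinl (Val.merge hR₁ (t₁, w)) :=
    (Val.measurable_unlift _).comp ((Val.measurable_merge _).comp measurable_prodMk_left)
  have hm₂ : Measurable fun w : Val 𝒳 (K \ B₂ : Set N) => Val.merge hR₂ (t₂, w) :=
    (Val.measurable_merge _).comp measurable_prodMk_left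
  change ((M.hard D).soft B).marginal ((o.hard D).soft B) (Sum.inl '' K) hK₁ t₁
    ((fun w => Val.unlift hinl (Val.merge hR₁ (t₁, w))) ⁻¹' E) = 0
  have h0 : (M.hard (D ∪ B₂)).marginal (o.hard (D ∪ B₂)) (K \ B₂) hK₂ t₂
    ((fun w => Val.merge hR₂ (t₂, w)) ⁻¹' E) = 0 := hae
  rw [← lintegral_indicator_one (hm₁ hE)]
  rw [← lintegral_indicator_one (hm₂ hE)] at h0
  rw [← h0]
  have hf : Measurable fun p : Val 𝒳 R × Val 𝒳 A => E.indicator (1 : Val 𝒳 R → ℝ≥0∞) p.1 :=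
    (measurable_one.indicator hE).comp measurable_fst
  have e₁ := Kernel.lintegral_map (((M.hard D).soft B).joint ((o.hard D).soft B))
    (Val.measurable_proj (hK₁.trans Set.sdiff_subset)) t₁
    ((measurable_one (α := ℝ≥0∞)).indicator (hm₁ hE))
  have e₂ := Kernel.lintegral_map ((M.hard (D ∪ B₂)).joint (o.hard (D ∪ B₂)))
    (Val.measurable_proj (hK₂.trans Set.sdiff_subset)) t₂
    ((measurable_one (α := ℝ≥0∞)).indicator (hm₂ hE))
  refine e₁.trans (Eq.trans ?_ e₂.symm)
  exact lintegral_joint_soft_pair o ht hB₂ (hA₂.trans Set.sdiff_subset)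
    (hK₂.trans Set.sdiff_subset) hR₂ (hB₂.trans (hB.trans Set.sdiff_subset))
    (fun w hw => ⟨w, ⟨(hA₂ hw).1.1, fun h => (hA₂ hw).1.2 (Or.inl h)⟩, rfl⟩)
    (hR₁.trans (Set.union_subset_union_right _ (hK₁.trans Set.sdiff_subset))) hf

end CausalBN

/-! ### Simultaneous versions for observations, and the three rules. -/

namespace CausalBN

open scoped ENNReal

variable {N : Type*} {𝒳 : N → Type*} [∀ v, MeasurableSpace (𝒳 v)]

/-- σ-separation of observed variables gives a simultaneous version of the conditional Markov
kernels given any subset of the separated variables. -/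
theorem exists_isVersion [Finite N] (M : CausalBN 𝒳) (o : M.G.TopOrder) {A B S C : Set N}
    (hA : A ⊆ M.V) (hB : B ⊆ M.V) (hC : C ⊆ M.V) (hCS : C ⊆ S) (hS : S ⊆ M.G.J ∪ C)
    (hAS : Disjoint A S) (hBS : Disjoint B S) (hsep : M.marginalGraph.SigmaSep A B S) :
    ∃ Q : Kernel (Val 𝒳 S) (Val 𝒳 A), IsMarkovKernel Q ∧
      ∀ B' ⊆ B, M.IsVersion o A (B' ∪ C) Q := by
  have hS' : S ⊆ M.G.J ∪ M.V := hS.trans (Set.union_subset_union_right _ hC)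
  obtain ⟨Q, hQ, h⟩ := M.transCI_joint o hA hB hS' hAS hBS hsep
  refine ⟨Q, hQ, fun B' hB' => ?_⟩
  have hBC : B' ∪ C ⊆ M.V := Set.union_subset (hB'.trans hB) hC
  have hSR : S ⊆ M.G.J ∪ (B' ∪ C) :=
    hS.trans (Set.union_subset_union_right _ Set.subset_union_right)
  refine M.isVersion_of_lintegral o Q hBC hA hSR fun t f hf => ?_
  have hBS' : B' ∪ C ⊆ S ∪ B := Set.union_subset (fun v hv => Or.inr (hB' hv)) fun v hv =>
    Or.inl (hCS hv)
  have hproj : ∀ x, Val.merge hBS' (Val.merge (subset_J_union hS') (t, x),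
      Val.proj (hB.trans Set.sdiff_subset) x) = Val.proj (hBC.trans Set.sdiff_subset) x := by
    intro x
    funext ⟨w, hw⟩
    by_cases hwS : w ∈ S
    · rw [Val.merge_of_mem _ _ _ _ hwS]
      exact Val.merge_of_notMem _ t x _ fun hJ => Set.disjoint_left.1 M.G.disj hJ (hBC hw).1
    · rw [Val.merge_of_notMem _ _ _ _ hwS]
      rfl
  -- Test functions of `X_{B' ∪ C}` are special test functions of `(X_S, X_B)`, so the kernel
  -- obtained for all of `B` works for each subset.
  have := h t (fun p => f (Val.merge hBS' (p.1, p.2.1), p.2.2))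
    (hf.comp (((Val.measurable_merge _).comp (measurable_fst.prodMk
      (measurable_fst.comp measurable_snd))).prodMk (measurable_snd.comp measurable_snd)))
  simp only [hproj] at this
  exact this

theorem agreeUpToNull_of_isVersion [Finite N] {M : CausalBN 𝒳} {o : M.G.TopOrder} {A S R : Set N}
    {Q Q' : Kernel (Val 𝒳 R) (Val 𝒳 A)} [IsMarkovKernel Q] [IsMarkovKernel Q']
    (h : M.IsVersion o A S Q) (h' : M.IsVersion o A S Q') : M.AgreeUpToNull o S Q Q' := by
  obtain ⟨hS, _, hR, -⟩ := id h
  exact ⟨hS, hR, fun t => h.ae_eq h' hS hR t⟩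

end CausalBN

theorem mainTheorem5 {N : Type*} [Finite N] {𝒳 : N → Type*} [∀ v, MeasurableSpace (𝒳 v)]
    (M : CausalBN 𝒳) (o : M.G.TopOrder) (A B C D : Set N)
    (hA : A ⊆ M.V) (hB : B ⊆ M.V) (hC : C ⊆ M.V) (hD : D ⊆ M.G.J ∪ M.V)
    (hAB : Disjoint A B) (hAC : Disjoint A C) (hAD : Disjoint A D)
    (hBC : Disjoint B C) (hBD : Disjoint B D) (hCD : Disjoint C D) :
    -- Insertion/deletion of observations
    ((M.hard D).marginalGraph.SigmaSep A B (C ∪ D) →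
      (∃ Q : Kernel (Val 𝒳 (C ∪ D)) (Val 𝒳 A), IsMarkovKernel Q ∧
        ∀ B' ⊆ B, (M.hard D).IsVersion (o.hard D) A (B' ∪ C) Q) ∧
      ∀ Q Q' : Kernel (Val 𝒳 (C ∪ D)) (Val 𝒳 A), IsMarkovKernel Q → IsMarkovKernel Q' →
        (∀ B' ⊆ B, (M.hard D).IsVersion (o.hard D) A (B' ∪ C) Q) →
        (∀ B' ⊆ B, (M.hard D).IsVersion (o.hard D) A (B' ∪ C) Q') →
        (M.hard D).AgreeUpToNull (o.hard D) C Q Q') ∧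
    -- Action/observation exchange
    (((M.hard D).soft B).marginalGraph.SigmaSep
        (Sum.inl '' A) (Sum.inr '' B) (Sum.inl '' (B ∪ C ∪ D)) →
      (∃ Q : Kernel (Val 𝒳 (B ∪ C ∪ D)) (Val 𝒳 A), IsMarkovKernel Q ∧
        ∀ B₁ B₂, Disjoint B₁ B₂ → B₁ ∪ B₂ = B →
          (M.hard (D ∪ B₂)).IsVersion (o.hard (D ∪ B₂)) A (B₁ ∪ C) Q) ∧
      ∀ Q Q' : Kernel (Val 𝒳 (B ∪ C ∪ D)) (Val 𝒳 A), IsMarkovKernel Q → IsMarkovKernel Q' →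
        (∀ B₁ B₂, Disjoint B₁ B₂ → B₁ ∪ B₂ = B →
          (M.hard (D ∪ B₂)).IsVersion (o.hard (D ∪ B₂)) A (B₁ ∪ C) Q) →
        (∀ B₁ B₂, Disjoint B₁ B₂ → B₁ ∪ B₂ = B →
          (M.hard (D ∪ B₂)).IsVersion (o.hard (D ∪ B₂)) A (B₁ ∪ C) Q') →
        ((M.hard D).soft B).AgreeUpToNull ((o.hard D).soft B)
          (Sum.inl '' (B ∪ C)) Q.lift Q'.lift) ∧
    -- Insertion/deletion of actions
    (((M.hard D).soft B).marginalGraph.SigmaSep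
        (Sum.inl '' A) (Sum.inr '' B) (Sum.inl '' (C ∪ D)) →
      (∃ Q : Kernel (Val 𝒳 (C ∪ D)) (Val 𝒳 A), IsMarkovKernel Q ∧
        ∀ B' ⊆ B, (M.hard (D ∪ B')).IsVersion (o.hard (D ∪ B')) A C Q) ∧
      ∀ Q Q' : Kernel (Val 𝒳 (C ∪ D)) (Val 𝒳 A), IsMarkovKernel Q → IsMarkovKernel Q' →
        (∀ B' ⊆ B, (M.hard (D ∪ B')).IsVersion (o.hard (D ∪ B')) A C Q) →
        (∀ B' ⊆ B, (M.hard (D ∪ B')).IsVersion (o.hard (D ∪ B')) A C Q') →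
        ((M.hard D).soft B).AgreeUpToNull ((o.hard D).soft B)
          (Sum.inl '' C) Q.lift Q'.lift) := by
  refine ⟨fun hsep => ⟨?_, ?_⟩, fun hsep => ⟨?_, ?_⟩, fun hsep => ⟨?_, ?_⟩⟩
  · refine (M.hard D).exists_isVersion (o.hard D) (CausalBN.subset_hard_V hA hAD)
      (CausalBN.subset_hard_V hB hBD) (CausalBN.subset_hard_V hC hCD) Set.subset_union_left ?_
      (Set.disjoint_union_right.2 ⟨hAC, hAD⟩) (Set.disjoint_union_right.2 ⟨hBC, hBD⟩) hsep
    exact Set.union_subset (fun v hv => Or.inr hv) fun v hv => Or.inl (Or.inr hv)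
  · intro Q Q' hQ hQ' h h'
    -- The choice `B' = ∅` suffices, and it gives a null set in terms of `X_C` alone.
    have := CausalBN.agreeUpToNull_of_isVersion (h ∅ (Set.empty_subset _))
      (h' ∅ (Set.empty_subset _))
    rwa [Set.empty_union] at this
  · have hR : B ∪ C ∪ D ⊆ M.G.J ∪ M.V ∪ D := by
      rintro v ((hv | hv) | hv)
      exacts [Or.inl (Or.inr (hB hv)), Or.inl (Or.inr (hC hv)), Or.inr hv]
    obtain ⟨Q, hQ, h⟩ := CausalBN.exists_isVersion_of_soft o hA hB hR hAB hAD
      (Set.disjoint_union_right.2 ⟨Set.disjoint_union_right.2 ⟨hAB, hAC⟩, hAD⟩) hsep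
    refine ⟨Q, hQ, fun B₁ B₂ hd hu => ?_⟩
    have hB₁ : B₁ ⊆ B := hu ▸ Set.subset_union_left
    have hB₂ : B₂ ⊆ B := hu ▸ Set.subset_union_right
    refine h B₂ hB₂ (B₁ ∪ C) ?_ (Set.union_subset (hB₁.trans hB) hC) ?_ ?_
    · rintro v (hv | hv)
      exacts [Or.inl (Or.inl (hB₁ hv)), Or.inl (Or.inr hv)]
    · rw [Set.disjoint_union_left, Set.disjoint_union_right, Set.disjoint_union_right]
      exact ⟨⟨hBD.mono_left hB₁, hd⟩, hCD, (hBC.mono_left hB₂).symm⟩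
    · rintro v ((hv | hv) | hv)
      · rw [← hu] at hv
        exact hv.elim (fun hv => Or.inr (Or.inl hv)) fun hv => Or.inl (Or.inr (Or.inr hv))
      · exact Or.inr (Or.inr hv)
      · exact Or.inl (Or.inr (Or.inl hv))
  · intro Q Q' hQ hQ' h h'
    -- The decomposition used for a given `B₂` is `B₁ = B \ B₂`.
    have hK : ∀ B₂ ⊆ B, (B ∪ C) \ B₂ = (B \ B₂) ∪ C := by
      intro B₂ hB₂
      rw [Set.union_sdiff_distrib, (hBC.mono_left hB₂).symm.sdiff_eq_left]
    refine CausalBN.agreeUpToNull_soft o hB hBD (Set.union_subset hB hC)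
      (Set.disjoint_union_left.2 ⟨hBD, hCD⟩) ?_ Q Q' (fun B₂ hB₂ => ?_) fun B₂ hB₂ => ?_
    · exact Set.union_subset (fun v hv => Or.inr hv) fun v hv => Or.inl (Or.inr hv)
    · rw [hK B₂ hB₂]
      exact h _ _ Set.disjoint_sdiff_left (Set.sdiff_union_of_subset hB₂)
    · rw [hK B₂ hB₂]
      exact h' _ _ Set.disjoint_sdiff_left (Set.sdiff_union_of_subset hB₂)
  · have hR : C ∪ D ⊆ M.G.J ∪ M.V ∪ D := by
      rintro v (hv | hv)
      exacts [Or.inl (Or.inr (hC hv)), Or.inr hv]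
    obtain ⟨Q, hQ, h⟩ := CausalBN.exists_isVersion_of_soft o hA hB hR hAB hAD
      (Set.disjoint_union_right.2 ⟨hAC, hAD⟩) hsep
    refine ⟨Q, hQ, fun B' hB' => h B' hB' C Set.subset_union_left hC ?_ ?_⟩
    · exact Set.disjoint_union_right.2 ⟨hCD, (hBC.mono_left hB').symm⟩
    · exact Set.union_subset (fun v hv => Or.inr hv) fun v hv => Or.inl (Or.inr (Or.inl hv))
  · intro Q Q' hQ hQ' h h'
    have hK : ∀ B₂ ⊆ B, C \ B₂ = C := fun B₂ hB₂ => (hBC.mono_left hB₂).symm.sdiff_eq_left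
    refine CausalBN.agreeUpToNull_soft o hB hBD hC hCD ?_ Q Q' (fun B₂ hB₂ => ?_) fun B₂ hB₂ => ?_
    · exact Set.union_subset (fun v hv => Or.inr hv) fun v hv => Or.inl (Or.inr hv)
    · rw [hK B₂ hB₂]
      exact h B₂ hB₂
    · rw [hK B₂ hB₂]
      exact h' B₂ hB₂
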